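/- Let the prototile be the right triangle with legs $1$ and $2$ and hypotenuse $\sqrt5$. The pinwheel dissection cuts a triangle similar to it, with right angle at $C$, short leg $CA$ and long leg $CB$, into five triangles similar to it with ratio $1/\sqrt5$: if $D=\tfrac{4A+B}{5}$, $E=\tfrac{2A+3B}{5}$, $F=\tfrac{B+C}{2}$ and $G=\tfrac{C+D}{2}$, these are $ACD$, $CFG$, $DFG$, $DEF$ and $BEF$. A level-$n$ supertile ($n\ge 0$) is the set of $5^n$ triangles obtained by applying this dissection $n$ times to a triangle congruent (reflections allowed) to the prototile scaled by $(\sqrt5)^n$. A pinwheel tiling is a tiling of the plane by triangles congruent (reflections allowed) to the prototile such that every finite set of its tiles is contained in a supertile of some level. Let $P$ be a pinwheel tiling, viewed as an infinite planar graph: its vertices are all corners of the tiles, and its edges are the segments into which these points divide the sides of the tiles (two distinct vertices are adjacent if and only if they lie on a common side of some tile and no vertex lies strictly between them). Then the chromatic index of $P$, that is, the least number of colours in a colouring of the edges in which any two distinct edges with a common endpoint receive different colours, is $\chi'(P)=8$. -/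

import Mathlib

namespace Pinwheel

/-- A right triangle in the plane `ℂ`, given by its three labelled corners: the corner `right` at the
right angle, the other end `short` of the short leg, and the other end `long` of the long leg. -/
@[ext]
structure Triangle where
  right : ℂ
  short : ℂ
  long : ℂ

namespace Triangle

/-- The set of the three corners. -/
def corners (T : Triangle) : Set ℂ := {T.right, T.short, T.long}

/-- The three sides: short leg, long leg, hypotenuse. -/
def sides (T : Triangle) : Set (Set ℂ) :=
  {segment ℝ T.right T.short, segment ℝ T.right T.long, segment ℝ T.short T.long}

/-- The closed triangular region. -/
def region (T : Triangle) : Set ℂ := convexHull ℝ T.corners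

/-- `T` is congruent (reflections allowed) to the prototile scaled by the factor `r`, the prototile
being the right triangle with legs `1` and `2` and hypotenuse `√5`. -/
def IsScaledPrototile (r : ℝ) (T : Triangle) : Prop :=
  dist T.right T.short = r ∧ dist T.right T.long = 2 * r ∧
    dist T.short T.long = Real.sqrt 5 * r

/-- The pinwheel dissection of a `1 : 2 : √5` triangle with right angle at `C`, short leg `CA` and
long leg `CB` into five triangles, similar to it with ratio `1 / √5`. Here `D` and `E` lie on the
hypotenuse, at one fifth and three fifths of the way from `A` to `B`, `F` is the midpoint of the
long leg, and `G` is the midpoint of `CD` (`CD` is the altitude). -/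
noncomputable def dissect (T : Triangle) : Set Triangle :=
  let C := T.right
  let A := T.short
  let B := T.long
  let D := (4 * A + B) / 5
  let E := (2 * A + 3 * B) / 5
  let F := (B + C) / 2
  let G := (C + D) / 2
  {⟨D, A, C⟩, ⟨G, C, F⟩, ⟨G, D, F⟩, ⟨E, F, D⟩, ⟨E, F, B⟩}

/-- The triangles obtained from `T` by applying the pinwheel dissection `n` times. -/
noncomputable def iterDissect : ℕ → Triangle → Set Triangle
  | 0, T => {T}
  | n + 1, T => ⋃ S ∈ dissect T, iterDissect n S

end Triangle

/-- The pinwheel substitution inflates a tile by `√5` and applies the pinwheel dissection. So the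
supertiles of level `n`, up to congruence, are the patches of unit-size tiles obtained from a
prototile scaled by `(√5) ^ n` by `n` dissections. -/
def IsSupertile (n : ℕ) (P : Set Triangle) : Prop :=
  ∃ S : Triangle, S.IsScaledPrototile (Real.sqrt 5 ^ n) ∧ P = S.iterDissect n

/-- `𝒯` is a pinwheel tiling: a tiling of the plane by congruent copies of the prototile, every
finite patch of which occurs in some supertile of the pinwheel substitution. -/
structure IsPinwheelTiling (𝒯 : Set Triangle) : Prop where
  isScaledPrototile : ∀ T ∈ 𝒯, T.IsScaledPrototile 1
  covers : ∀ z : ℂ, ∃ T ∈ 𝒯, z ∈ T.region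
  disjoint_interior : ∀ T ∈ 𝒯, ∀ T' ∈ 𝒯, T ≠ T' →
    Disjoint (interior T.region) (interior T'.region)
  legal : ∀ F : Set Triangle, F.Finite → F ⊆ 𝒯 → ∃ (n : ℕ) (P : Set Triangle),
    IsSupertile n P ∧ F ⊆ P

/-- The vertices of a tiling: all corners of its tiles. -/
def vertices (𝒯 : Set Triangle) : Set ℂ := {z | ∃ T ∈ 𝒯, z ∈ T.corners}

/-- The graph of a tiling. Its vertices are the corners of the tiles, and its edges are the segments
into which these points divide the sides of the tiles: two distinct vertices are adjacent if they lie
on a common side of a tile and no vertex lies strictly between them. -/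
def tilingGraph (𝒯 : Set Triangle) : SimpleGraph (vertices 𝒯) where
  Adj x y := x ≠ y ∧ (∃ T ∈ 𝒯, ∃ s ∈ T.sides, (x : ℂ) ∈ s ∧ (y : ℂ) ∈ s) ∧
    ∀ z ∈ vertices 𝒯, z ∉ openSegment ℝ (x : ℂ) (y : ℂ)
  symm := ⟨fun x y h => ⟨h.1.symm,
    (by obtain ⟨T, hT, s, hs, hx, hy⟩ := h.2.1; exact ⟨T, hT, s, hs, hy, hx⟩),
    by rw [openSegment_symm]; exact h.2.2⟩⟩
  loopless := ⟨fun _ h => h.1 rfl⟩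

end Pinwheel

/-- The chromatic index of a graph: the least number of colours in a colouring of the edges in which
any two distinct edges with a common endpoint have different colours (`⊤` if no finite number of
colours suffices). -/
noncomputable def SimpleGraph.chromaticIndex {V : Type*} (G : SimpleGraph V) : ℕ∞ :=
  G.lineGraph.chromaticNumber

/-! Upper bound. By compactness (`IsPinwheelTiling.colorable`) it suffices to colour finitely many
edges, and these can be placed in one supertile. A tile of a supertile is a word in the five
dissection maps. Each map carries a label in `ZMod 8`; labels add along the word, with a reflection
negating what follows. The colour of an edge is the label of a chosen tile carrying it plus an
offset depending on the kind of edge and the orientation of the tile. This rule is equivariant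
(`EdgeKind.colour_mul`), so whether two edges clash depends only on the relative position of their
tiles.

Relative positions of meeting tiles of equal level form a finite list, closed under dissection
(`neighbours_closed`, `exists_neighbour`), so properness becomes a finite check
(`neighbours_proper_or`). The check is made on the children of two neighbouring parents, because a
side can have a vertex inside it only at the midpoint of a long leg, and the position of a tile in
its parent controls this midpoint: present for child 0, absent for children 1 and 2, and present for
both or neither of children 3 and 4. One flag per parent thus records which edges exist.

Lower bound. Every pinwheel tiling contains a complete level-two supertile
(`IsPinwheelTiling.exists_supertile_two`), inside which eight edges leave one vertex
(`IsPinwheelTiling.eight_le`). -/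

namespace Pinwheel

/-! ### Labelled similarities in integer coordinates -/

/-- A similarity of the plane with integral coefficients, to be read relative to a scale `n`: the map
`z ↦ ((x + y i) + (p + q i) z) / n`, where `z` is conjugated first if `flip` is set. The label
records a direction and a parity, and determines the colours of edges. -/
structure Placement where
  x : ℤ
  y : ℤ
  p : ℤ
  q : ℤ
  flip : Bool
  label : ZMod 8
deriving DecidableEq

/-- The sign by which the conjugation `f` acts on imaginary parts. -/
def sgn (f : Bool) : ℤ := bif f then -1 else 1

/-- The action of a conjugation on labels. -/
def signed (f : Bool) (k : ZMod 8) : ZMod 8 := bif f then -k else k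

namespace Placement

/-- The composition of `a` and `b`, where `b` has scale `s`. -/
def comp (s : ℤ) (a b : Placement) : Placement where
  x := s * a.x + (a.p * b.x - a.q * (sgn a.flip * b.y))
  y := s * a.y + (a.p * (sgn a.flip * b.y) + a.q * b.x)
  p := a.p * b.p - a.q * (sgn a.flip * b.q)
  q := a.p * (sgn a.flip * b.q) + a.q * b.p
  flip := xor a.flip b.flip
  label := a.label + signed a.flip b.label

/-- The identity at scale `s`. -/
def unit (s : ℤ) : Placement := ⟨0, 0, s, 0, false, 0⟩

/-- The image of an integral point. -/
def pt (a : Placement) (w : ℤ × ℤ) : ℤ × ℤ :=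
  (a.x + (a.p * w.1 - a.q * (sgn a.flip * w.2)), a.y + (a.p * (sgn a.flip * w.2) + a.q * w.1))

/-- First coordinate of `z` in the frame of `a`, up to the factor `a.nrm`. -/
def locX (a : Placement) (z : ℤ × ℤ) : ℤ := (z.1 - a.x) * a.p + (z.2 - a.y) * a.q

/-- Second coordinate of `z` in the frame of `a`, up to the factor `a.nrm`. -/
def locY (a : Placement) (z : ℤ × ℤ) : ℤ :=
  sgn a.flip * ((z.2 - a.y) * a.p - (z.1 - a.x) * a.q)

/-- The squared norm of the linear part. -/
def nrm (a : Placement) : ℤ := a.p * a.p + a.q * a.q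

/-- The corners of the tile `b` all lie strictly beyond one side of the tile `a`. -/
def Beyond (a b : Placement) : Prop :=
  (a.locY (b.pt (0, 0)) < 0 ∧ a.locY (b.pt (0, 1)) < 0 ∧ a.locY (b.pt (2, 0)) < 0) ∨
  (a.locX (b.pt (0, 0)) < 0 ∧ a.locX (b.pt (0, 1)) < 0 ∧ a.locX (b.pt (2, 0)) < 0) ∨
  (2 * a.nrm < a.locX (b.pt (0, 0)) + 2 * a.locY (b.pt (0, 0)) ∧
    2 * a.nrm < a.locX (b.pt (0, 1)) + 2 * a.locY (b.pt (0, 1)) ∧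
    2 * a.nrm < a.locX (b.pt (2, 0)) + 2 * a.locY (b.pt (2, 0)))

instance (a b : Placement) : Decidable (Beyond a b) := by unfold Beyond; infer_instance

end Placement

open Placement

/-! ### Finite tables: relative positions of meeting tiles -/

/-- The five tiles of the dissected prototile, at scale `5`. -/
def kid : Fin 5 → Placement
  | 0 => ⟨2, 4, -1, -2, true, 5⟩
  | 1 => ⟨1, 2, 2, -1, true, 3⟩
  | 2 => ⟨1, 2, 2, -1, false, 3⟩
  | 3 => ⟨6, 2, -2, 1, false, 3⟩
  | 4 => ⟨6, 2, 2, -1, true, 7⟩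

/-- The positions, at scale `25`, of a tile relative to a tile that it meets. -/
def neighbours : List Placement :=
  [⟨0, 0, 25, 0, false, 0⟩, ⟨25, 0, 0, -25, false, 2⟩, ⟨25, 0, 0, -25, true, 2⟩,
   ⟨0, -50, 0, 25, true, 2⟩, ⟨0, -25, 0, 25, false, 6⟩, ⟨0, 0, 25, 0, true, 0⟩,
   ⟨50, -25, -25, 0, true, 0⟩, ⟨50, -25, 25, 0, false, 4⟩, ⟨0, 25, 0, -25, true, 2⟩,
   ⟨50, 25, -25, 0, false, 0⟩, ⟨50, 25, 25, 0, true, 4⟩, ⟨50, 0, 0, 25, true, 2⟩,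
   ⟨50, 25, -25, 0, true, 0⟩, ⟨0, 0, -25, 0, true, 4⟩, ⟨-50, 25, 25, 0, false, 4⟩,
   ⟨-50, 25, 25, 0, true, 4⟩, ⟨100, 0, -25, 0, false, 4⟩, ⟨75, 0, 0, 25, false, 6⟩,
   ⟨100, 0, -25, 0, true, 4⟩, ⟨75, 0, 0, -25, true, 2⟩, ⟨-25, 25, 0, 25, true, 2⟩,
   ⟨25, 25, 0, 25, false, 2⟩, ⟨65, -20, -20, -15, true, 0⟩, ⟨20, 40, 15, -20, true, 6⟩,
   ⟨35, 20, 20, 15, true, 4⟩, ⟨20, -40, 15, 20, false, 2⟩, ⟨35, -20, 20, -15, false, 4⟩,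
   ⟨30, 65, -15, -20, false, 2⟩, ⟨15, 45, -20, 15, false, 4⟩, ⟨-30, 65, 15, -20, true, 2⟩,
   ⟨-15, 45, 20, 15, true, 0⟩, ⟨80, -40, -15, 20, true, 2⟩, ⟨40, 55, -20, -15, true, 0⟩,
   ⟨0, 75, 0, -25, false, 2⟩, ⟨0, 75, 0, -25, true, 2⟩, ⟨-25, 25, 0, -25, false, 6⟩,
   ⟨20, 40, 15, -20, false, 6⟩, ⟨70, 15, -15, 20, false, 6⟩, ⟨70, 15, 15, -20, true, 2⟩,
   ⟨20, -40, 15, 20, true, 2⟩, ⟨70, -15, -15, -20, true, 2⟩, ⟨70, -15, 15, 20, false, 6⟩,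
   ⟨30, 65, -15, -20, true, 2⟩, ⟨-20, 40, 15, 20, true, 2⟩, ⟨-20, 40, -15, -20, false, 6⟩,
   ⟨-30, 65, 15, -20, false, 2⟩, ⟨20, 40, -15, 20, false, 2⟩, ⟨-40, -5, 20, 15, true, 4⟩,
   ⟨-40, -5, 20, 15, false, 4⟩, ⟨-15, 45, -20, -15, false, 4⟩, ⟨25, 25, -25, 0, true, 4⟩,
   ⟨25, 0, -25, 0, false, 0⟩, ⟨25, 0, 25, 0, true, 4⟩, ⟨25, -25, -25, 0, true, 4⟩,
   ⟨-25, 0, 25, 0, true, 4⟩, ⟨-20, 10, -15, 20, true, 2⟩, ⟨-25, 0, 0, -25, false, 2⟩,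
   ⟨0, -50, 0, 25, false, 2⟩, ⟨0, 25, 0, 25, false, 6⟩, ⟨0, 50, 25, 0, true, 0⟩,
   ⟨50, 0, 0, -25, false, 6⟩, ⟨0, 0, -25, 0, false, 4⟩, ⟨64, 48, -7, -24, true, 4⟩,
   ⟨57, 24, 24, -7, true, 2⟩, ⟨65, -20, 20, 15, false, 4⟩, ⟨-48, 39, 24, -7, true, 2⟩,
   ⟨-24, 32, 7, 24, true, 0⟩, ⟨-40, 55, 20, -15, false, 4⟩, ⟨50, -50, 0, 25, false, 2⟩,
   ⟨50, -50, 0, 25, true, 2⟩, ⟨50, 50, 0, -25, false, 6⟩, ⟨0, 50, -25, 0, false, 4⟩,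
   ⟨90, 30, -20, -15, true, 4⟩, ⟨90, -30, -20, 15, false, 4⟩, ⟨90, 30, -20, -15, false, 4⟩]

/-- The induction step for `exists_neighbour`: children of neighbours are either strictly separated
by a side of one of them, or again in a listed position. Labels are part of the equation, so the
list also controls relative labels. -/
theorem neighbours_closed : ∀ r ∈ neighbours, ∀ i j : Fin 5,
    Beyond (comp 25 (kid i) (unit 25)) (comp 5 r (kid j)) ∨
    Beyond (comp 5 r (kid j)) (comp 25 (kid i) (unit 25)) ∨
    ∃ r' ∈ neighbours, comp 25 (kid i) r' = comp 5 r (kid j) := by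
  decide +kernel

/-- The corners of a tile, in its own frame. -/
def cornerCoords : List (ℤ × ℤ) := [(0, 0), (0, 1), (2, 0)]

theorem neighbours_corner_mem : ∀ r ∈ neighbours, ∀ w ∈ cornerCoords,
    0 ≤ (r.pt w).1 → 0 ≤ (r.pt w).2 → (r.pt w).1 + 2 * (r.pt w).2 ≤ 50 →
    r.pt w ∈ [((0 : ℤ), (0 : ℤ)), (0, 25), (50, 0), (25, 0)] := by
  decide +kernel

/-- An interior point of the prototile, at scale `25`, as a degenerate placement. -/
def centre : Placement := ⟨12, 8, 0, 0, false, 0⟩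

/-- Turns "two tiles overlap at this interior point" into "the two tiles are equal". -/
theorem neighbours_centre : ∀ r ∈ neighbours, r = unit 25 ∨ Beyond r centre := by
  decide +kernel

/-- The `i`-th tile in the dissection of the prototile, at scale `125`. -/
def ownKid (i : Fin 5) : Placement := comp 25 (kid i) (unit 25)

/-- The `j`-th tile in the dissection of a neighbour of the prototile, at scale `125`. -/
def nbKid (r : Placement) (j : Fin 5) : Placement := comp 5 r (kid j)

/-- Both long legs are the segment `GF`, whose midpoint is interior to the dissected triangle. -/
theorem neighbours_mid_one_two : ∀ r ∈ neighbours, ∀ j : Fin 5, ∀ w ∈ cornerCoords,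
    (nbKid r j).pt w ≠ (ownKid 1).pt (1, 0) ∧ (nbKid r j).pt w ≠ (ownKid 2).pt (1, 0) := by
  decide +kernel

/-- The long legs here are `ED` and `EB`, the two parts of the hypotenuse meeting at `E`. Dividing
them always happens simultaneously, which is why a single flag per parent suffices. -/
theorem neighbours_mid_three_four : ∀ r ∈ neighbours,
    ((∃ j : Fin 5, ∃ w ∈ cornerCoords, (nbKid r j).pt w = (ownKid 3).pt (1, 0)) ↔
      ∃ j : Fin 5, ∃ w ∈ cornerCoords, (nbKid r j).pt w = (ownKid 4).pt (1, 0)) := by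
  decide +kernel

/-! ### Edge colours and the finite properness check -/

/-- The ways in which an edge of the tiling can lie on the boundary of a tile: the whole short leg,
the hypotenuse, the half of the long leg near the right angle, its other half, and the long leg. -/
inductive EdgeKind
  | short
  | hyp
  | near
  | far
  | long
deriving DecidableEq

namespace EdgeKind

instance : Fintype EdgeKind := ⟨{short, hyp, near, far, long}, by rintro (_ | _) <;> decide⟩

/-- One end of the edge, in the frame of the tile. -/
def fst : EdgeKind → ℤ × ℤ
  | hyp => (0, 1)
  | far => (1, 0)
  | _ => (0, 0)

/-- The other end of the edge, in the frame of the tile. -/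
def snd : EdgeKind → ℤ × ℤ
  | short => (0, 1)
  | near => (1, 0)
  | _ => (2, 0)

/-- The colour of an edge of a tile with orientation `f` and label `l`. -/
def colour (f : Bool) (l : ZMod 8) : EdgeKind → ZMod 8
  | short => l + signed f 2
  | hyp => l + 4 - signed f 1
  | near => l
  | _ => l + 4

/-- Which edges occur on the `i`-th tile in the dissection of a tile; `d` tells whether the
long legs on the hypotenuse of the dissected tile are divided. -/
def Occurs (i : Fin 5) (d : Bool) : EdgeKind → Bool
  | short => true
  | hyp => true
  | long => i == 1 || i == 2 || (i != 0 && !d)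
  | _ => i == 0 || (i != 1 && i != 2 && d)

end EdgeKind

/-- The flags `d` and `d'`, telling whether the long legs on the hypotenuse of the prototile and of
its neighbour `r` are divided, do not contradict each other. -/
def Compatible (r : Placement) (d d' : Bool) : Prop :=
  (∀ j : Fin 5, ∀ w ∈ cornerCoords, (nbKid r j).pt w = (ownKid 3).pt (1, 0) → d = true) ∧
  (∀ i : Fin 5, ∀ w ∈ cornerCoords, (ownKid i).pt w = (nbKid r 3).pt (1, 0) → d' = true) ∧
  ((ownKid 3).pt (1, 0) = (nbKid r 3).pt (1, 0) ∨
    (ownKid 3).pt (1, 0) = (nbKid r 4).pt (1, 0) → d = d')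

instance (r : Placement) (d d' : Bool) : Decidable (Compatible r d d') := by
  unfold Compatible; infer_instance

/-- The segments from `x` to `y` and from `x'` to `y'` have a common end. -/
def Meet {α : Type*} (x y x' y' : α) : Prop := x = x' ∨ x = y' ∨ y = x' ∨ y = y'

/-- The segments from `x` to `y` and from `x'` to `y'` have the same ends. -/
def SameEnds {α : Type*} (x y x' y' : α) : Prop := (x = x' ∧ y = y') ∨ (x = y' ∧ y = x')

instance {α : Type*} [DecidableEq α] (x y x' y' : α) : Decidable (Meet x y x' y') := by
  unfold Meet; infer_instance

instance {α : Type*} [DecidableEq α] (x y x' y' : α) : Decidable (SameEnds x y x' y') := by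
  unfold SameEnds; infer_instance

/-- The edge `k` of the tile `a` and the edge `k'` of the tile `b` do not violate the condition
on an edge colouring. -/
def Proper (a b : Placement) (k k' : EdgeKind) : Prop :=
  Meet (a.pt k.fst) (a.pt k.snd) (b.pt k'.fst) (b.pt k'.snd) →
    SameEnds (a.pt k.fst) (a.pt k.snd) (b.pt k'.fst) (b.pt k'.snd) ∨
      k.colour a.flip a.label ≠ k'.colour b.flip b.label

instance (a b : Placement) (k k' : EdgeKind) : Decidable (Proper a b k k') := by
  unfold Proper; infer_instance

/-- The computational heart of the upper bound. An apparent clash is allowed only if the two edges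
cannot coexist for any compatible choice of flags. -/
theorem neighbours_proper_or : ∀ r ∈ neighbours, ∀ i j : Fin 5,
    Beyond (ownKid i) (nbKid r j) ∨ Beyond (nbKid r j) (ownKid i) ∨
      ∀ k k' : EdgeKind, Proper (ownKid i) (nbKid r j) k k' ∨
        ∀ d d' : Bool, k.Occurs i d → k'.Occurs j d' → ¬Compatible r d d' := by
  decide +kernel

theorem neighbours_proper {r : Placement} (hr : r ∈ neighbours) {d d' : Bool}
    (hd : Compatible r d d') {i j : Fin 5} (hb : ¬Beyond (ownKid i) (nbKid r j))
    (hb' : ¬Beyond (nbKid r j) (ownKid i)) {k k' : EdgeKind} (hk : k.Occurs i d)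
    (hk' : k'.Occurs j d') : Proper (ownKid i) (nbKid r j) k k' := by
  rcases neighbours_proper_or r hr i j with h | h | h
  · exact absurd h hb
  · exact absurd h hb'
  · exact (h k k').resolve_right fun h => h d d' hk hk' hd

/-! ### Similarities of the complex plane -/

open Complex

/-- Complex conjugation if `f` is set, and otherwise the identity. -/
def conjIf (f : Bool) (z : ℂ) : ℂ := ⟨z.re, sgn f * z.im⟩

/-- A labelled similarity `z ↦ c + u z` or `z ↦ c + u z̄` of the plane. -/
@[ext]
structure Motion where
  c : ℂ
  u : ℂ
  flip : Bool
  label : ZMod 8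

namespace Motion

/-- The similarity underlying a motion. -/
def app (T : Motion) (z : ℂ) : ℂ := T.c + T.u * conjIf T.flip z

instance : Mul Motion :=
  ⟨fun S T => ⟨S.app T.c, S.u * conjIf S.flip T.u, xor S.flip T.flip,
    S.label + signed S.flip T.label⟩⟩

theorem mul_c (S T : Motion) : (S * T).c = S.app T.c := rfl
theorem mul_u (S T : Motion) : (S * T).u = S.u * conjIf S.flip T.u := rfl
theorem mul_flip (S T : Motion) : (S * T).flip = xor S.flip T.flip := rfl
theorem mul_label (S T : Motion) : (S * T).label = S.label + signed S.flip T.label := rfl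

theorem mul_app (S T : Motion) (z : ℂ) : (S * T).app z = S.app (T.app z) := by
  apply Complex.ext <;> cases hS : S.flip <;> cases hT : T.flip <;>
    simp [app, mul_c, mul_u, mul_flip, conjIf, sgn, hS, hT] <;> ring

theorem mul_assoc' (S T U : Motion) : S * T * U = S * (T * U) := by
  ext1
  · simp only [mul_c, mul_app]
  · apply Complex.ext <;> cases hS : S.flip <;> cases hT : T.flip <;>
      simp [mul_u, mul_flip, conjIf, sgn, hS, hT] <;> ring
  · simp [mul_flip]
  · cases hS : S.flip <;> cases hT : T.flip <;>
      simp [mul_label, mul_flip, signed, hS, hT] <;> ring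

theorem conjIf_injective (f : Bool) : Function.Injective (conjIf f) := by
  intro z w h
  have h1 := congrArg Complex.re h
  have h2 := congrArg Complex.im h
  cases f <;> simp [conjIf, sgn] at h1 h2 <;> exact Complex.ext h1 h2

theorem app_injective {T : Motion} (hT : T.u ≠ 0) : Function.Injective T.app := by
  intro z w h
  exact conjIf_injective _ (mul_left_cancel₀ hT (add_left_cancel h))

theorem conjIf_eq_zero {f : Bool} {z : ℂ} : conjIf f z = 0 ↔ z = 0 := by
  have h0 : conjIf f 0 = 0 := by apply Complex.ext <;> simp [conjIf]
  exact ⟨fun h => conjIf_injective f (h.trans h0.symm), fun h => h ▸ h0⟩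

theorem mul_u_ne_zero {S T : Motion} (hS : S.u ≠ 0) (hT : T.u ≠ 0) : (S * T).u ≠ 0 :=
  mul_ne_zero hS fun h => hT (conjIf_eq_zero.1 h)

theorem app_combo (T : Motion) (z w : ℂ) {a b : ℝ} (hab : a + b = 1) :
    T.app (a • z + b • w) = a • T.app z + b • T.app w := by
  obtain rfl : b = 1 - a := by linarith
  apply Complex.ext <;> cases hT : T.flip <;> simp [app, conjIf, sgn, hT] <;> ring

/-- The triangle at position `T`. -/
noncomputable def tri (T : Motion) : Triangle := ⟨T.app 0, T.app I, T.app 2⟩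

end Motion

/-- The prototile with legs on the coordinate axes. -/
def prototile : Set ℂ := {w | 0 ≤ w.re ∧ 0 ≤ w.im ∧ w.re + 2 * w.im ≤ 2}

theorem convex_prototile : Convex ℝ prototile := by
  rintro z ⟨h1, h2, h3⟩ w ⟨h4, h5, h6⟩ a b ha hb hab
  refine ⟨?_, ?_, ?_⟩
  · simp; positivity
  · simp; positivity
  · simp only [Complex.add_re, Complex.add_im, Complex.real_smul, Complex.re_ofReal_mul,
      Complex.im_ofReal_mul]
    nlinarith [mul_le_mul_of_nonneg_left h3 ha, mul_le_mul_of_nonneg_left h6 hb]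

theorem Motion.region_tri_subset (T : Motion) : T.tri.region ⊆ T.app '' prototile := by
  refine convexHull_min ?_ ?_
  · rintro z (rfl | rfl | rfl)
    · exact ⟨0, by simp [prototile], rfl⟩
    · exact ⟨I, by simp [prototile], rfl⟩
    · exact ⟨2, by simp [prototile], rfl⟩
  · rintro _ ⟨z, hz, rfl⟩ _ ⟨w, hw, rfl⟩ a b ha hb hab
    exact ⟨_, convex_prototile hz hw ha hb hab, T.app_combo z w hab⟩

/-- The complex number with given integral coordinates. -/
def coord (w : ℤ × ℤ) : ℂ := ⟨w.1, w.2⟩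

namespace Placement

/-- The motion described by a placement at scale `n`. -/
noncomputable def toMotion (n : ℤ) (a : Placement) : Motion :=
  ⟨⟨a.x / n, a.y / n⟩, ⟨a.p / n, a.q / n⟩, a.flip, a.label⟩

theorem toMotion_comp {n s : ℤ} (hn : n ≠ 0) (hs : s ≠ 0) (a b : Placement) :
    (comp s a b).toMotion (n * s) = a.toMotion n * b.toMotion s := by
  have hn' : (n : ℝ) ≠ 0 := by exact_mod_cast hn
  have hs' : (s : ℝ) ≠ 0 := by exact_mod_cast hs
  ext1
  · apply Complex.ext <;> simp [toMotion, comp, Motion.mul_c, Motion.app, conjIf] <;> field_simp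
  · apply Complex.ext <;> simp [toMotion, comp, Motion.mul_u, conjIf] <;> field_simp
  · rfl
  · rfl

theorem mul_toMotion_unit {s : ℤ} (hs : s ≠ 0) (T : Motion) : T * (unit s).toMotion s = T := by
  have hs' : (s : ℝ) ≠ 0 := by exact_mod_cast hs
  ext1
  · apply Complex.ext <;> simp [toMotion, unit, Motion.mul_c, Motion.app, conjIf]
  · apply Complex.ext <;> simp [toMotion, unit, Motion.mul_u, conjIf, hs']
  · simp [toMotion, unit, Motion.mul_flip]
  · cases h : T.flip <;> simp [toMotion, unit, Motion.mul_label, signed, h]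

theorem app_coord (n : ℤ) (a : Placement) (w : ℤ × ℤ) :
    (a.toMotion n).app (coord w) = coord (a.pt w) / n := by
  apply Complex.ext <;> simp [toMotion, Motion.app, coord, pt, conjIf] <;> ring

theorem toMotion_u_ne_zero {n : ℤ} (hn : n ≠ 0) {a : Placement} (ha : a.nrm ≠ 0) :
    (a.toMotion n).u ≠ 0 := by
  have hn' : (n : ℝ) ≠ 0 := by exact_mod_cast hn
  intro h
  have h1 := congrArg Complex.re h
  have h2 := congrArg Complex.im h
  simp [toMotion, hn'] at h1 h2
  exact ha (by simp [nrm, h1, h2])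

/-- A side line of `a` strictly separates the two tiles: an affine function that is nonnegative on
`a` is negative at the corners of `b`, hence on all of `b`. -/
theorem Beyond.app_ne {a b : Placement} (h : Beyond a b) {n : ℤ} (hn : n ≠ 0) {w w' : ℂ}
    (hw : w ∈ prototile) (hw' : w' ∈ prototile) :
    (a.toMotion n).app w ≠ (b.toMotion n).app w' := by
  intro e
  obtain ⟨h1, h2, h3⟩ := hw
  obtain ⟨h1', h2', h3'⟩ := hw'
  have hn' : (n : ℝ) ≠ 0 := by exact_mod_cast hn
  have ex := congrArg Complex.re e
  have ey := congrArg Complex.im e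
  simp [toMotion, Motion.app, conjIf] at ex ey
  field_simp at ex ey
  have hN : (0 : ℝ) ≤ a.p * a.p + a.q * a.q :=
    add_nonneg (mul_self_nonneg _) (mul_self_nonneg _)
  have hX := mul_nonneg hN h1
  have hY := mul_nonneg hN h2
  have hS := mul_le_mul_of_nonneg_left h3 hN
  have hee : (sgn a.flip : ℝ) * sgn a.flip = 1 := by cases a.flip <;> simp [sgn]
  -- The weights are the barycentric coordinates of `w'` with respect to the corners `0`, `I`, `2`.
  have key : ∀ l0 l1 l2 : ℝ, l0 < 0 → l1 < 0 → l2 < 0 →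
      (1 - w'.re / 2 - w'.im) * l0 + w'.im * l1 + (w'.re / 2) * l2 < 0 := by
    intro l0 l1 l2 h0 h1 h2
    have i1 : (1 - w'.re / 2 - w'.im) * l0 ≤ 0 :=
      mul_nonpos_of_nonneg_of_nonpos (by linarith) h0.le
    have i2 : w'.im * l1 ≤ 0 := mul_nonpos_of_nonneg_of_nonpos h2' h1.le
    have i3 : (w'.re / 2) * l2 ≤ 0 := mul_nonpos_of_nonneg_of_nonpos (by linarith) h2.le
    rcases h1'.lt_or_eq with hp | hp
    · nlinarith
    rcases h2'.lt_or_eq with hq | hq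
    · nlinarith
    rw [← hp, ← hq]; linarith
  have hy : (a.p * a.p + a.q * a.q : ℝ) * w.im =
      (1 - w'.re / 2 - w'.im) * (a.locY (b.pt (0, 0)) : ℝ) + w'.im * (a.locY (b.pt (0, 1)) : ℝ) +
        (w'.re / 2) * (a.locY (b.pt (2, 0)) : ℝ) := by
    simp only [locY, pt]
    push_cast
    linear_combination (sgn a.flip : ℝ) * a.p * ey - (sgn a.flip : ℝ) * a.q * ex -
      (a.p * a.p + a.q * a.q : ℝ) * w.im * hee
  have hx : (a.p * a.p + a.q * a.q : ℝ) * w.re =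
      (1 - w'.re / 2 - w'.im) * (a.locX (b.pt (0, 0)) : ℝ) + w'.im * (a.locX (b.pt (0, 1)) : ℝ) +
        (w'.re / 2) * (a.locX (b.pt (2, 0)) : ℝ) := by
    simp only [locX, pt]
    push_cast
    linear_combination (a.p : ℝ) * ex + (a.q : ℝ) * ey
  rcases h with ⟨c1, c2, c3⟩ | ⟨c1, c2, c3⟩ | ⟨c1, c2, c3⟩
  · have := key _ _ _ (Int.cast_lt_zero.2 c1) (Int.cast_lt_zero.2 c2) (Int.cast_lt_zero.2 c3)
    linarith
  · have := key _ _ _ (Int.cast_lt_zero.2 c1) (Int.cast_lt_zero.2 c2) (Int.cast_lt_zero.2 c3)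
    linarith
  · have cast : ∀ z : ℤ × ℤ, 2 * a.nrm < a.locX z + 2 * a.locY z →
        (2 * (a.p * a.p + a.q * a.q) - a.locX z - 2 * a.locY z : ℝ) < 0 := by
      intro z hz
      have : ((2 * a.nrm : ℤ) : ℝ) < ((a.locX z + 2 * a.locY z : ℤ) : ℝ) := by exact_mod_cast hz
      simp only [nrm] at this
      push_cast at this
      linarith
    have := key _ _ _ (cast _ c1) (cast _ c2) (cast _ c3)
    nlinarith

end Placement

/-! ### Iterated dissection as words, and the neighbour relation -/

theorem kid_nrm_ne_zero : ∀ i, (kid i).nrm ≠ 0 := by decide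

/-- The tile obtained by successive passages to a tile of the dissection, as prescribed by a list
read from its end. -/
noncomputable def descend (S : Motion) : List (Fin 5) → Motion
  | [] => S
  | i :: l => descend S l * (kid i).toMotion 5

/-- The head of a word is the last dissection, as the induction on neighbours needs, whereas
`Triangle.iterDissect` peels off the first one. This lemma reconciles the two. -/
theorem descend_append (S : Motion) (l : List (Fin 5)) (i : Fin 5) :
    descend S (l ++ [i]) = descend (S * (kid i).toMotion 5) l := by
  induction l with
  | nil => rfl
  | cons j l ih => simp [descend, ih]

theorem descend_u_ne_zero {S : Motion} (hS : S.u ≠ 0) (l : List (Fin 5)) :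
    (descend S l).u ≠ 0 := by
  induction l with
  | nil => exact hS
  | cons j l ih =>
    exact Motion.mul_u_ne_zero ih (Placement.toMotion_u_ne_zero (by norm_num) (kid_nrm_ne_zero j))

theorem Motion.dissect_tri (T : Motion) :
    T.tri.dissect = Set.range fun i => (T * (kid i).toMotion 5).tri := by
  have hk : ∀ i : Fin 5, (T * (kid i).toMotion 5).tri =
      ⟨T.app (((kid i).toMotion 5).app 0), T.app (((kid i).toMotion 5).app I),
        T.app (((kid i).toMotion 5).app 2)⟩ := fun i => by simp [tri, mul_app]
  have hf : ∀ f : Fin 5 → Triangle, Set.range f = {f 0, f 1, f 2, f 3, f 4} := by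
    intro f; ext x; simp [Fin.exists_fin_succ, eq_comm]
  have e0 : (T * (kid 0).toMotion 5).tri =
      ⟨(4 * T.app I + T.app 2) / 5, T.app I,
        T.app 0⟩ := by
    rw [hk]; ext1 <;> apply Complex.ext <;> cases hT : T.flip <;>
      simp [app, conjIf, sgn, hT, kid, toMotion] <;> ring
  have e1 : (T * (kid 1).toMotion 5).tri =
      ⟨(T.app 0 + (4 * T.app I + T.app 2) / 5) / 2, T.app 0,
        (T.app 2 + T.app 0) / 2⟩ := by
    rw [hk]; ext1 <;> apply Complex.ext <;> cases hT : T.flip <;>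
      simp [app, conjIf, sgn, hT, kid, toMotion] <;> ring_nf <;> simp
  have e2 : (T * (kid 2).toMotion 5).tri =
      ⟨(T.app 0 + (4 * T.app I + T.app 2) / 5) / 2, (4 * T.app I + T.app 2) / 5,
        (T.app 2 + T.app 0) / 2⟩ := by
    rw [hk]; ext1 <;> apply Complex.ext <;> cases hT : T.flip <;>
      simp [app, conjIf, sgn, hT, kid, toMotion] <;> ring
  have e3 : (T * (kid 3).toMotion 5).tri =
      ⟨(2 * T.app I + 3 * T.app 2) / 5, (T.app 2 + T.app 0) / 2,
        (4 * T.app I + T.app 2) / 5⟩ := by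
    rw [hk]; ext1 <;> apply Complex.ext <;> cases hT : T.flip <;>
      simp [app, conjIf, sgn, hT, kid, toMotion] <;> ring
  have e4 : (T * (kid 4).toMotion 5).tri =
      ⟨(2 * T.app I + 3 * T.app 2) / 5, (T.app 2 + T.app 0) / 2,
        T.app 2⟩ := by
    rw [hk]; ext1 <;> apply Complex.ext <;> cases hT : T.flip <;>
      simp [app, conjIf, sgn, hT, kid, toMotion] <;> ring
  rw [hf, e0, e1, e2, e3, e4]
  rfl

theorem Motion.iterDissect_tri (S : Motion) (n : ℕ) :
    S.tri.iterDissect n = {T | ∃ l : List (Fin 5), l.length = n ∧ T = (descend S l).tri} := by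
  induction n generalizing S with
  | zero =>
    ext T
    simp [Triangle.iterDissect, List.length_eq_zero_iff, descend]
  | succ n ih =>
    ext T
    simp only [Triangle.iterDissect, dissect_tri, Set.biUnion_range, ih, Set.mem_iUnion,
      Set.mem_ofPred_eq]
    constructor
    · rintro ⟨i, l, hl, rfl⟩
      exact ⟨l ++ [i], by simp [hl], by rw [descend_append]⟩
    · rintro ⟨l, hl, rfl⟩
      obtain ⟨l', i, rfl⟩ := List.eq_nil_or_concat' l |>.resolve_left (by rintro rfl; simp at hl)
      exact ⟨i, l', by simpa using hl, by rw [descend_append]⟩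

theorem kid_app_mem (i : Fin 5) {w : ℂ} (hw : w ∈ prototile) :
    ((kid i).toMotion 5).app w ∈ prototile := by
  obtain ⟨h1, h2, h3⟩ := hw
  fin_cases i <;> refine ⟨?_, ?_, ?_⟩ <;> simp [kid, toMotion, Motion.app, conjIf, sgn] <;> linarith

theorem toMotion_kid (i : Fin 5) : (kid i).toMotion 5 = (ownKid i).toMotion 125 := by
  have h := toMotion_comp (n := 5) (s := 25) (by norm_num) (by norm_num) (kid i) (unit 25)
  rw [mul_toMotion_unit (by norm_num)] at h
  rw [← h]; rfl

theorem mul_toMotion_kid (r : Placement) (j : Fin 5) :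
    r.toMotion 25 * (kid j).toMotion 5 = (nbKid r j).toMotion 125 :=
  (toMotion_comp (n := 25) (s := 5) (by norm_num) (by norm_num) r (kid j)).symm

/-- Two tiles of the same level in the same supertile that meet are neighbours. -/
theorem exists_neighbour {S : Motion} (hS : S.u ≠ 0) :
    ∀ {l l' : List (Fin 5)}, l.length = l'.length → ∀ {w w' : ℂ}, w ∈ prototile → w' ∈ prototile →
      (descend S l).app w = (descend S l').app w' →
      ∃ r ∈ neighbours, descend S l' = descend S l * r.toMotion 25
  | [], [], _, _, _, _, _, _ =>
    ⟨unit 25, by decide +kernel, (mul_toMotion_unit (by norm_num) _).symm⟩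
  | [], _ :: _, h, _, _, _, _, _ => by simp at h
  | _ :: _, [], h, _, _, _, _, _ => by simp at h
  | i :: l, j :: l', h, w, w', hw, hw', e => by
    simp only [descend, Motion.mul_app] at e
    obtain ⟨r, hr, hrel⟩ := exists_neighbour hS (by simpa using h) (kid_app_mem i hw)
      (kid_app_mem j hw') e
    rw [hrel, Motion.mul_app] at e
    have e := Motion.app_injective (descend_u_ne_zero hS l) e
    rw [← Motion.mul_app, mul_toMotion_kid, toMotion_kid] at e
    rcases neighbours_closed r hr i j with hb | hb | ⟨r', hr', h'⟩
    · exact absurd e (hb.app_ne (by norm_num) hw hw')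
    · exact absurd e.symm (hb.app_ne (by norm_num) hw' hw)
    · refine ⟨r', hr', ?_⟩
      have h5 := toMotion_comp (n := 5) (s := 25) (by norm_num) (by norm_num) (kid i) r'
      rw [h'] at h5
      have h6 := mul_toMotion_kid r j
      simp only [nbKid] at h6
      norm_num at h5
      rw [descend, descend, hrel, Motion.mul_assoc', h6, h5, Motion.mul_assoc']

/-! ### Supertiles inside a tiling -/

theorem Triangle.IsScaledPrototile.exists_motion {T : Triangle} {r : ℝ}
    (hT : T.IsScaledPrototile r) (hr : 0 < r) : ∃ M : Motion, M.u ≠ 0 ∧ M.tri = T := by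
  obtain ⟨h1, h2, h3⟩ := hT
  have hsq : ∀ z w : ℂ, dist z w ^ 2 = (z.re - w.re) ^ 2 + (z.im - w.im) ^ 2 := by
    intro z w
    rw [Complex.dist_eq, Complex.sq_norm, Complex.normSq_apply]
    simp; ring
  have s1 := hsq T.right T.short
  have s2 := hsq T.right T.long
  have s3 := hsq T.short T.long
  rw [h1] at s1
  rw [h2] at s2
  rw [h3, mul_pow, Real.sq_sqrt (by norm_num)] at s3
  obtain ⟨u, hu⟩ : ∃ u : ℂ, u = (T.long - T.right) / 2 := ⟨_, rfl⟩
  obtain ⟨a, ha⟩ : ∃ a : ℂ, a = T.short - T.right := ⟨_, rfl⟩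
  have hlong : T.long = T.right + 2 * u := by rw [hu]; ring
  have hshort : T.short = T.right + a := by rw [ha]; ring
  rw [hshort] at s1 s3
  rw [hlong] at s2 s3
  simp at s1 s2 s3
  have hu2 : u.re ^ 2 + u.im ^ 2 = r ^ 2 := by linarith
  have ha2 : a.re ^ 2 + a.im ^ 2 = r ^ 2 := by linarith
  have hdot : a.re * u.re + a.im * u.im = 0 := by linarith
  -- Lagrange's identity; the sign of the cross product then decides whether a reflection is needed.
  have hcross : (u.re * a.im - u.im * a.re) ^ 2 = (r ^ 2) ^ 2 := by
    linear_combination (u.re ^ 2 + u.im ^ 2) * ha2 + r ^ 2 * hu2 -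
      (a.re * u.re + a.im * u.im) * hdot
  have hr2 : r ^ 2 ≠ 0 := by positivity
  have hu0 : u ≠ 0 := by
    rintro rfl
    simp at hu2
    exact hr2 hu2.symm
  rcases sq_eq_sq_iff_eq_or_eq_neg.1 hcross with hc | hc
  · have e1 : a.re = -u.im := mul_left_cancel₀ hr2 (by
      linear_combination u.re * hdot - u.im * hc - a.re * hu2)
    have e2 : a.im = u.re := mul_left_cancel₀ hr2 (by
      linear_combination u.im * hdot + u.re * hc - a.im * hu2)
    refine ⟨⟨T.right, u, false, 0⟩, hu0, ?_⟩
    ext1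
    · apply Complex.ext <;> simp [Motion.tri, Motion.app, conjIf]
    · rw [hshort]; apply Complex.ext <;> simp [Motion.tri, Motion.app, conjIf, sgn, e1, e2]
    · rw [hlong]; apply Complex.ext <;> simp [Motion.tri, Motion.app, conjIf] <;> ring
  · have e1 : a.re = u.im := mul_left_cancel₀ hr2 (by
      linear_combination u.re * hdot - u.im * hc - a.re * hu2)
    have e2 : a.im = -u.re := mul_left_cancel₀ hr2 (by
      linear_combination u.im * hdot + u.re * hc - a.im * hu2)
    refine ⟨⟨T.right, u, true, 0⟩, hu0, ?_⟩
    ext1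
    · apply Complex.ext <;> simp [Motion.tri, Motion.app, conjIf]
    · rw [hshort]; apply Complex.ext <;> simp [Motion.tri, Motion.app, conjIf, sgn, e1, e2]
    · rw [hlong]; apply Complex.ext <;> simp [Motion.tri, Motion.app, conjIf] <;> ring

/-- The point with given coordinates in the frame of a triangle. -/
noncomputable def Triangle.point (T : Triangle) (z : ℂ) : ℂ :=
  T.right + (z.re / 2 : ℝ) • (T.long - T.right) + (z.im : ℝ) • (T.short - T.right)

theorem Motion.point_tri (T : Motion) (z : ℂ) : T.tri.point z = T.app z := by
  apply Complex.ext <;> cases hT : T.flip <;>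
    simp [Triangle.point, tri, app, conjIf, sgn, hT] <;> ring

theorem Motion.app_eq_of_tri_eq {M M' : Motion} (h : M.tri = M'.tri) (z : ℂ) :
    M.app z = M'.app z := by
  rw [← point_tri, ← point_tri, h]

/-- The tiles of the supertile obtained by dissecting `S` `n` times. -/
def supertile (S : Motion) (n : ℕ) : Set Triangle :=
  {T | ∃ l : List (Fin 5), l.length = n ∧ T = (descend S l).tri}

theorem IsSupertile.exists_eq {n : ℕ} {P : Set Triangle} (h : IsSupertile n P) :
    ∃ S : Motion, S.u ≠ 0 ∧ P = supertile S n := by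
  obtain ⟨T, hT, rfl⟩ := h
  obtain ⟨S, hS, rfl⟩ := hT.exists_motion (by positivity)
  exact ⟨S, hS, S.iterDissect_tri n⟩

theorem IsPinwheelTiling.infinite {𝒯 : Set Triangle} (h𝒯 : IsPinwheelTiling 𝒯) : 𝒯.Infinite := by
  intro hfin
  refine noncompact_univ ℂ ?_
  have : (Set.univ : Set ℂ) = ⋃ T ∈ 𝒯, T.region := by
    symm
    rw [Set.eq_univ_iff_forall]
    intro z
    obtain ⟨T, hT, hz⟩ := h𝒯.covers z
    exact Set.mem_biUnion hT hz
  rw [this]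
  refine hfin.isCompact_biUnion fun T _ => ?_
  exact Set.Finite.isCompact_convexHull ℝ (by simp [Triangle.corners])

/-- Supertiles of level 0 and 1 have at most five tiles. -/
theorem two_le_of_six_le {S : Motion} {n : ℕ} {F : Finset Triangle} (hF : F.card = 6)
    (h : (F : Set Triangle) ⊆ supertile S n) : 2 ≤ n := by
  classical
  by_contra! hn
  suffices hs : ∃ f : Fin 5 → Triangle, supertile S n ⊆ Set.range f by
    obtain ⟨f, hf⟩ := hs
    have h1 : F ⊆ Finset.univ.image f := by
      intro T hT
      obtain ⟨i, rfl⟩ := hf (h hT)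
      simp
    have h2 := Finset.card_le_card h1
    have h3 : (Finset.univ.image f).card ≤ 5 := Finset.card_image_le
    omega
  interval_cases n
  · refine ⟨fun _ => S.tri, ?_⟩
    rintro T ⟨l, hl, rfl⟩
    obtain rfl := List.length_eq_zero_iff.1 hl
    exact ⟨0, rfl⟩
  · refine ⟨fun i => (descend S [i]).tri, ?_⟩
    rintro T ⟨l, hl, rfl⟩
    obtain ⟨i, rfl⟩ := List.length_eq_one_iff.1 hl
    exact ⟨i, rfl⟩

theorem centre_app (w : ℂ) : (centre.toMotion 25).app w = (centre.toMotion 25).app 0 := by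
  simp [Motion.app, toMotion, centre, Complex.ext_iff]

theorem centre_app_mem : (centre.toMotion 25).app 0 ∈ prototile := by
  simp [prototile, Motion.app, toMotion, centre]
  norm_num

theorem descend_eq_of_centre_mem {S : Motion} (hS : S.u ≠ 0) {l l' : List (Fin 5)}
    (hl : l.length = l'.length)
    (h : (descend S l).app ((centre.toMotion 25).app 0) ∈ (descend S l').tri.region) :
    descend S l' = descend S l := by
  obtain ⟨w, hw, e⟩ := Motion.region_tri_subset _ h
  obtain ⟨r, hr, hrel⟩ := exists_neighbour hS hl centre_app_mem hw e.symm
  rw [hrel, Motion.mul_app] at e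
  have e := Motion.app_injective (descend_u_ne_zero hS l) e
  rcases neighbours_centre r hr with rfl | hb
  · rw [hrel, mul_toMotion_unit (by norm_num)]
  · rw [← centre_app w] at e
    exact absurd e (hb.app_ne (by norm_num) hw hw)

/-- Every finite set of tiles of a pinwheel tiling lies in a supertile such that those among
finitely many given triangles that belong to the supertile also belong to the tiling. -/
theorem IsPinwheelTiling.exists_supertile {𝒯 : Set Triangle} (h𝒯 : IsPinwheelTiling 𝒯)
    {F Y : Set Triangle} (hF : F.Finite) (hF𝒯 : F ⊆ 𝒯) (hY : Y.Finite) :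
    ∃ (S : Motion) (n : ℕ), S.u ≠ 0 ∧ F ⊆ supertile S (n + 2) ∧
      Y ∩ supertile S (n + 2) ⊆ 𝒯 := by
  choose cov hcov hmem using h𝒯.covers
  obtain ⟨G, hG, hG6⟩ := h𝒯.infinite.exists_subset_card_eq 6
  -- For each candidate triangle, a tile of the tiling covering its centre is put into the patch as
  -- well. If the candidate belongs to the supertile, the two share an interior point there and so
  -- coincide.
  let f : Triangle → Triangle := fun T => cov (T.point ((centre.toMotion 25).app 0))
  obtain ⟨m, P, hP, hsub⟩ := h𝒯.legal (F ∪ G ∪ f '' Y)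
    ((hF.union G.finite_toSet).union (hY.image f))
    (Set.union_subset (Set.union_subset hF𝒯 hG) (by rintro _ ⟨T, -, rfl⟩; exact hcov _))
  obtain ⟨S, hS, rfl⟩ := hP.exists_eq
  have h2 : 2 ≤ m := two_le_of_six_le hG6 fun T hT => hsub (Or.inl (Or.inr hT))
  obtain ⟨n, rfl⟩ := Nat.exists_eq_add_of_le' h2
  refine ⟨S, n, hS, fun T hT => hsub (Or.inl (Or.inl hT)), ?_⟩
  rintro T ⟨hTY, l, hl, rfl⟩
  obtain ⟨l', hl', e⟩ := hsub (Or.inr ⟨_, hTY, rfl⟩)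
  have hz := hmem ((descend S l).tri.point ((centre.toMotion 25).app 0))
  have hc := hcov ((descend S l).tri.point ((centre.toMotion 25).app 0))
  simp only [f] at e
  rw [e] at hz hc
  rw [Motion.point_tri] at hz
  rwa [descend_eq_of_centre_mem hS (hl.trans hl'.symm) hz] at hc

/-! ### Vertices lying on a tile -/

theorem Motion.mem_corners_iff {M : Motion} {z : ℂ} :
    z ∈ M.tri.corners ↔ ∃ q ∈ cornerCoords, z = M.app (coord q) := by
  have h0 : coord (0, 0) = 0 := by simp [coord, Complex.ext_iff]
  have h1 : coord (0, 1) = I := by simp [coord, Complex.ext_iff]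
  have h2 : coord (2, 0) = 2 := by simp [coord, Complex.ext_iff]
  simp [Triangle.corners, tri, cornerCoords, h0, h1, h2]

/-- The points of a tile, in its own frame, that can be vertices: the corners and the midpoint of
the long leg. -/
def nodeCoords : List (ℤ × ℤ) := [(0, 0), (0, 1), (2, 0), (1, 0)]

theorem coord_mem_prototile {q : ℤ × ℤ} (hq : q ∈ nodeCoords) : coord q ∈ prototile := by
  simp only [nodeCoords, List.mem_cons, List.not_mem_nil, or_false] at hq
  rcases hq with rfl | rfl | rfl | rfl <;> simp [coord, prototile]

theorem cornerCoords_subset {q : ℤ × ℤ} (hq : q ∈ cornerCoords) : q ∈ nodeCoords := by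
  simp only [cornerCoords, nodeCoords, List.mem_cons, List.not_mem_nil, or_false] at hq ⊢
  tauto

theorem coord_div_injective {n : ℤ} (hn : n ≠ 0) {z w : ℤ × ℤ} (h : coord z / n = coord w / n) :
    z = w := by
  have hn' : (n : ℂ) ≠ 0 := by exact_mod_cast hn
  have h := (div_left_inj' hn').1 h
  have h1 := congrArg Complex.re h
  have h2 := congrArg Complex.im h
  simp [coord] at h1 h2
  exact Prod.ext h1 h2

theorem exists_node_of_corner_mem {S : Motion} (hS : S.u ≠ 0) {l l' : List (Fin 5)}
    (hl : l.length = l'.length) {q : ℤ × ℤ} (hq : q ∈ cornerCoords) {w : ℂ} (hw : w ∈ prototile)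
    (h : (descend S l).app w = (descend S l').app (coord q)) :
    ∃ p ∈ nodeCoords, w = coord p := by
  obtain ⟨r, hr, hrel⟩ := exists_neighbour hS hl hw (coord_mem_prototile (cornerCoords_subset hq)) h
  rw [hrel, Motion.mul_app, app_coord] at h
  have h := Motion.app_injective (descend_u_ne_zero hS l) h
  have h1 : w.re = (r.pt q).1 / 25 := by rw [h]; simp [coord]
  have h2 : w.im = (r.pt q).2 / 25 := by rw [h]; simp [coord]
  obtain ⟨w1, w2, w3⟩ := hw
  rw [h1] at w1 w3
  rw [h2] at w2 w3
  have i1 : (0 : ℝ) ≤ (r.pt q).1 := by linarith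
  have i2 : (0 : ℝ) ≤ (r.pt q).2 := by linarith
  have i3 : ((r.pt q).1 : ℝ) + 2 * (r.pt q).2 ≤ 50 := by linarith
  have hm := neighbours_corner_mem r hr q hq (by exact_mod_cast i1) (by exact_mod_cast i2)
    (by exact_mod_cast i3)
  simp only [List.mem_cons, List.not_mem_nil, or_false] at hm
  have hmk : ∀ {a b : ℤ}, r.pt q = (25 * a, 25 * b) → w = coord (a, b) := by
    intro a b hab
    rw [h, hab]
    apply Complex.ext <;> simp [coord]
  rcases hm with e | e | e | e
  · exact ⟨(0, 0), by decide, hmk e⟩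
  · exact ⟨(0, 1), by decide, hmk e⟩
  · exact ⟨(2, 0), by decide, hmk e⟩
  · exact ⟨(1, 0), by decide, hmk e⟩

/-- The vertices of a pinwheel tiling that lie on one of its tiles are corners of the tile or the
midpoint of its long leg. -/
theorem IsPinwheelTiling.exists_node {𝒯 : Set Triangle} (h𝒯 : IsPinwheelTiling 𝒯) {M : Motion}
    (hM : M.tri ∈ 𝒯) {w : ℂ} (hw : w ∈ prototile) (h : M.app w ∈ vertices 𝒯) :
    ∃ p ∈ nodeCoords, w = coord p := by
  obtain ⟨T, hT, hz⟩ := h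
  obtain ⟨n, P, hP, hsub⟩ := h𝒯.legal {M.tri, T} (by simp) (by
    rintro U (rfl | rfl) <;> assumption)
  obtain ⟨S, hS, rfl⟩ := hP.exists_eq
  obtain ⟨l, hl, e⟩ := hsub (Or.inl rfl)
  obtain ⟨l', hl', rfl⟩ := hsub (Or.inr rfl)
  obtain ⟨q, hq, e'⟩ := Motion.mem_corners_iff.1 hz
  rw [Motion.app_eq_of_tri_eq e] at e'
  exact exists_node_of_corner_mem hS (hl.trans hl'.symm) hq hw e'

/-! ### Properness of the colouring of a supertile -/

/-- Passing to the frame of a common reference tile changes all colours by one and the same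
permutation of `ZMod 8`, so inequality of colours can be tested in that frame. -/
theorem EdgeKind.colour_mul (f g : Bool) (l m : ZMod 8) (k : EdgeKind) :
    k.colour (xor f g) (l + signed f m) = l + signed f (k.colour g m) := by
  have h4 : (-4 : ZMod 8) = 4 := by decide
  have h5 : (5 : ZMod 8) = -3 := by decide
  cases k <;> cases f <;> cases g <;> simp [colour, signed, h4] <;> ring_nf
  rw [h5]

theorem signed_injective (f : Bool) : Function.Injective (signed f) := by
  cases f <;> intro a b h <;> simpa [signed] using h

theorem vertices_supertile {S : Motion} {n : ℕ} {z : ℂ} :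
    z ∈ vertices (supertile S n) ↔
      ∃ l : List (Fin 5), l.length = n ∧ ∃ q ∈ cornerCoords, z = (descend S l).app (coord q) := by
  constructor
  · rintro ⟨_, ⟨l, hl, rfl⟩, hz⟩
    exact ⟨l, hl, Motion.mem_corners_iff.1 hz⟩
  · rintro ⟨l, hl, hz⟩
    exact ⟨_, ⟨l, hl, rfl⟩, Motion.mem_corners_iff.2 hz⟩

theorem app_kid (A : Motion) (i : Fin 5) (q : ℤ × ℤ) :
    (A * (kid i).toMotion 5).app (coord q) = A.app (coord ((ownKid i).pt q) / (125 : ℤ)) := by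
  rw [toMotion_kid, Motion.mul_app, app_coord]

theorem app_mul_kid (A : Motion) (r : Placement) (j : Fin 5) (q : ℤ × ℤ) :
    (A * r.toMotion 25 * (kid j).toMotion 5).app (coord q) =
      A.app (coord ((nbKid r j).pt q) / (125 : ℤ)) := by
  rw [Motion.mul_assoc', mul_toMotion_kid, Motion.mul_app, app_coord]

theorem ownKid_mem_prototile (i : Fin 5) {q : ℤ × ℤ} (hq : q ∈ nodeCoords) :
    coord ((ownKid i).pt q) / (125 : ℤ) ∈ prototile := by
  rw [← app_coord, ← toMotion_kid]
  exact kid_app_mem i (coord_mem_prototile hq)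

theorem exists_nbKid {S : Motion} (hS : S.u ≠ 0) {l : List (Fin 5)} {w : ℂ} (hw : w ∈ prototile)
    (h : (descend S l).app w ∈ vertices (supertile S (l.length + 1))) :
    ∃ r ∈ neighbours, (∃ j, ∃ q ∈ cornerCoords, w = coord ((nbKid r j).pt q) / (125 : ℤ)) ∧
      ∀ j, ∀ q ∈ cornerCoords, (descend S l).app (coord ((nbKid r j).pt q) / (125 : ℤ)) ∈
        vertices (supertile S (l.length + 1)) := by
  obtain ⟨_ | ⟨j, l'⟩, hl, q, hq, e⟩ := vertices_supertile.1 h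
  · simp at hl
  have hl : l'.length = l.length := by simpa using hl
  have e' := e
  rw [descend, Motion.mul_app] at e'
  obtain ⟨r, hr, hrel⟩ := exists_neighbour hS hl.symm hw
    (kid_app_mem j (coord_mem_prototile (cornerCoords_subset hq))) e'
  refine ⟨r, hr, ⟨j, q, hq, ?_⟩, fun j q hq => ?_⟩
  · rw [descend, hrel, app_mul_kid] at e
    exact Motion.app_injective (descend_u_ne_zero hS l) e
  · rw [← app_mul_kid, ← hrel]
    exact vertices_supertile.2 ⟨j :: l', by simp [hl], q, hq, rfl⟩

/-- The long leg of child 0 is `DC`; its midpoint `G` is the right-angled corner of child 1. -/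
theorem mid_mem {S : Motion} (l : List (Fin 5)) :
    (descend S (0 :: l)).app (coord (1, 0)) ∈ vertices (supertile S (l.length + 1)) := by
  refine vertices_supertile.2 ⟨1 :: l, by simp, (0, 0), by decide, ?_⟩
  rw [descend, descend, app_kid, app_kid]
  rfl

theorem mid_one_two_not_mem {S : Motion} (hS : S.u ≠ 0) (l : List (Fin 5)) {i : Fin 5}
    (hi : i = 1 ∨ i = 2) :
    (descend S (i :: l)).app (coord (1, 0)) ∉ vertices (supertile S (l.length + 1)) := by
  intro h
  rw [descend, app_kid] at h
  obtain ⟨r, hr, ⟨j, q, hq, e⟩, -⟩ := exists_nbKid hS (ownKid_mem_prototile i (by decide)) h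
  have e := coord_div_injective (by norm_num) e
  have := neighbours_mid_one_two r hr j q hq
  rcases hi with rfl | rfl
  · exact this.1 e.symm
  · exact this.2 e.symm

theorem mid_three_iff_four {S : Motion} (hS : S.u ≠ 0) (l : List (Fin 5)) :
    (descend S (3 :: l)).app (coord (1, 0)) ∈ vertices (supertile S (l.length + 1)) ↔
      (descend S (4 :: l)).app (coord (1, 0)) ∈ vertices (supertile S (l.length + 1)) := by
  rw [descend, descend, app_kid, app_kid]
  constructor <;> intro h <;>
    obtain ⟨r, hr, ⟨j, q, hq, e⟩, hall⟩ := exists_nbKid hS (ownKid_mem_prototile _ (by decide)) h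
  · obtain ⟨j', q', hq', e'⟩ := (neighbours_mid_three_four r hr).1
      ⟨j, q, hq, (coord_div_injective (by norm_num) e).symm⟩
    rw [← e']
    exact hall j' q' hq'
  · obtain ⟨j', q', hq', e'⟩ := (neighbours_mid_three_four r hr).2
      ⟨j, q, hq, (coord_div_injective (by norm_num) e).symm⟩
    rw [← e']
    exact hall j' q' hq'

/-- The edge `k` of the tile `T` is an edge of the graph with vertex set `V`. -/
def EdgeKind.Valid (k : EdgeKind) (T : Motion) (V : Set ℂ) : Prop :=
  ((k = near ∨ k = far) → T.app (coord (1, 0)) ∈ V) ∧ (k = long → T.app (coord (1, 0)) ∉ V)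

theorem EdgeKind.Valid.occurs {S : Motion} (hS : S.u ≠ 0) {l : List (Fin 5)} {i : Fin 5}
    {k : EdgeKind} (hk : k.Valid (descend S (i :: l)) (vertices (supertile S (l.length + 1))))
    {d : Bool} (hd : d = true ↔
      (descend S (3 :: l)).app (coord (1, 0)) ∈ vertices (supertile S (l.length + 1))) :
    k.Occurs i d = true := by
  have h34 := mid_three_iff_four hS l
  have h0 := mid_mem (S := S) l
  have h1 := mid_one_two_not_mem hS l (i := 1) (by simp)
  have h2 := mid_one_two_not_mem hS l (i := 2) (by simp)
  have hi : i = 0 ∨ i = 1 ∨ i = 2 ∨ i = 3 ∨ i = 4 := by clear hk; revert i; decide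
  obtain ⟨ha, hb⟩ := hk
  rcases hi with rfl | rfl | rfl | rfl | rfl <;> cases d <;> cases k <;>
    simp_all [EdgeKind.Occurs]

theorem EdgeKind.fst_mem (k : EdgeKind) : k.fst ∈ nodeCoords := by cases k <;> decide

theorem EdgeKind.snd_mem (k : EdgeKind) : k.snd ∈ nodeCoords := by cases k <;> decide

/-- The colouring of the edges of a supertile is proper. -/
theorem colour_ne_of_meet {S : Motion} (hS : S.u ≠ 0) {l l' : List (Fin 5)}
    (hl : l.length = l'.length) {i j : Fin 5} {k k' : EdgeKind}
    (hk : k.Valid (descend S (i :: l)) (vertices (supertile S (l.length + 1))))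
    (hk' : k'.Valid (descend S (j :: l')) (vertices (supertile S (l.length + 1))))
    (hmeet : Meet ((descend S (i :: l)).app (coord k.fst)) ((descend S (i :: l)).app (coord k.snd))
      ((descend S (j :: l')).app (coord k'.fst)) ((descend S (j :: l')).app (coord k'.snd)))
    (hne : ¬SameEnds ((descend S (i :: l)).app (coord k.fst))
      ((descend S (i :: l)).app (coord k.snd)) ((descend S (j :: l')).app (coord k'.fst))
      ((descend S (j :: l')).app (coord k'.snd))) :
    k.colour (descend S (i :: l)).flip (descend S (i :: l)).label ≠
      k'.colour (descend S (j :: l')).flip (descend S (j :: l')).label := by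
  classical
  obtain ⟨p, hp, p', hp', hpp⟩ : ∃ p ∈ nodeCoords, ∃ p' ∈ nodeCoords,
      (descend S (i :: l)).app (coord p) = (descend S (j :: l')).app (coord p') := by
    rcases hmeet with h | h | h | h
    exacts [⟨_, k.fst_mem, _, k'.fst_mem, h⟩, ⟨_, k.fst_mem, _, k'.snd_mem, h⟩,
      ⟨_, k.snd_mem, _, k'.fst_mem, h⟩, ⟨_, k.snd_mem, _, k'.snd_mem, h⟩]
  -- The children lie inside their parents, so the parents meet too and are neighbours.
  obtain ⟨r, hr, hrel⟩ : ∃ r ∈ neighbours, descend S l' = descend S l * r.toMotion 25 := by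
    have e := hpp
    rw [descend, descend, Motion.mul_app, Motion.mul_app] at e
    exact exists_neighbour hS hl (kid_app_mem i (coord_mem_prototile hp))
      (kid_app_mem j (coord_mem_prototile hp')) e
  have inj := Motion.app_injective (descend_u_ne_zero hS l)
  have own : ∀ i q, (descend S (i :: l)).app (coord q) =
      (descend S l).app (coord ((ownKid i).pt q) / (125 : ℤ)) := fun i q => by rw [descend, app_kid]
  have nb : ∀ j q, (descend S (j :: l')).app (coord q) =
      (descend S l).app (coord ((nbKid r j).pt q) / (125 : ℤ)) := fun j q => by
    rw [descend, hrel, app_mul_kid]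
  have pt_eq : ∀ z w : ℤ × ℤ, (descend S l).app (coord z / (125 : ℤ)) =
      (descend S l).app (coord w / (125 : ℤ)) ↔ z = w := fun z w =>
    ⟨fun h => coord_div_injective (by norm_num) (inj h), fun h => by rw [h]⟩
  have vert : ∀ m : List (Fin 5), m.length = l.length → ∀ j, ∀ q ∈ cornerCoords,
      (descend S (j :: m)).app (coord q) ∈ vertices (supertile S (l.length + 1)) :=
    fun m hm j q hq => vertices_supertile.2 ⟨j :: m, by simp [hm], q, hq, rfl⟩
  set V := vertices (supertile S (l.length + 1)) with hV
  have hV' : V = vertices (supertile S (l'.length + 1)) := by rw [hV, hl]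
  -- The true flags of the two parents are compatible because both are read off from the same vertex
  -- set.
  have hcomp : Compatible r (decide ((descend S (3 :: l)).app (coord (1, 0)) ∈ V))
      (decide ((descend S (3 :: l')).app (coord (1, 0)) ∈ V)) := by
    refine ⟨fun j q hq e => ?_, fun i q hq e => ?_, fun e => ?_⟩
    · rw [decide_eq_true_iff, own, ← e, ← nb]
      exact vert l' hl.symm j q hq
    · rw [decide_eq_true_iff, nb, ← e, ← own]
      exact vert l rfl i q hq
    · have h34 : (descend S (3 :: l')).app (coord (1, 0)) ∈ V ↔
          (descend S (4 :: l')).app (coord (1, 0)) ∈ V := by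
        rw [hV']; exact mid_three_iff_four hS l'
      rw [decide_eq_decide]
      rcases e with e | e
      · rw [own, nb, e]
      · rw [h34, own, nb, e]
  rw [own, nb, pt_eq] at hpp
  have hpp' : ((ownKid i).toMotion 125).app (coord p) =
      ((nbKid r j).toMotion 125).app (coord p') := by rw [app_coord, app_coord, hpp]
  have hprop := neighbours_proper hr hcomp
    (fun hb => hb.app_ne (by norm_num) (coord_mem_prototile hp) (coord_mem_prototile hp') hpp')
    (fun hb => hb.app_ne (by norm_num) (coord_mem_prototile hp') (coord_mem_prototile hp)
      hpp'.symm) (hk.occurs hS decide_eq_true_iff)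
    (EdgeKind.Valid.occurs hS (hV' ▸ hk') (by rw [decide_eq_true_iff, hV']))
  simp only [own, nb, Meet, SameEnds, pt_eq] at hmeet hne
  have hcol := (hprop hmeet).resolve_left hne
  have e1 : descend S (i :: l) = descend S l * (ownKid i).toMotion 125 := by
    rw [descend, toMotion_kid]
  have e2 : descend S (j :: l') = descend S l * (nbKid r j).toMotion 125 := by
    rw [descend, hrel, Motion.mul_assoc', mul_toMotion_kid]
  rw [e1, e2, Motion.mul_flip, Motion.mul_flip, Motion.mul_label, Motion.mul_label,
    EdgeKind.colour_mul, EdgeKind.colour_mul]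
  intro h
  exact hcol (signed_injective _ (add_left_cancel h))

/-! ### Edges of the tiling as parts of sides -/

theorem Motion.exists_of_mem_segment {M : Motion} {a b z : ℂ}
    (hz : z ∈ segment ℝ (M.app a) (M.app b)) : ∃ w ∈ segment ℝ a b, z = M.app w := by
  obtain ⟨s, t, hs, ht, hst, rfl⟩ := hz
  exact ⟨_, ⟨s, t, hs, ht, hst, rfl⟩, (M.app_combo a b hst).symm⟩

theorem Motion.mid_mem_openSegment (M : Motion) :
    M.app (coord (1, 0)) ∈ openSegment ℝ (M.app (coord (0, 0))) (M.app (coord (2, 0))) := by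
  refine ⟨1 / 2, 1 / 2, by norm_num, by norm_num, by norm_num, ?_⟩
  rw [← M.app_combo _ _ (by norm_num)]
  congr 1
  apply Complex.ext <;> simp [coord]

theorem short_side {p : ℤ × ℤ} (hp : p ∈ nodeCoords) (h : coord p ∈ segment ℝ 0 I) :
    p = (0, 0) ∨ p = (0, 1) := by
  obtain ⟨s, t, hs, ht, hst, e⟩ := h
  have h1 := congrArg Complex.re e
  simp only [nodeCoords, List.mem_cons, List.not_mem_nil, or_false] at hp
  rcases hp with rfl | rfl | rfl | rfl <;> simp [coord] at h1 ⊢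

theorem long_side {p : ℤ × ℤ} (hp : p ∈ nodeCoords) (h : coord p ∈ segment ℝ 0 2) :
    p = (0, 0) ∨ p = (1, 0) ∨ p = (2, 0) := by
  obtain ⟨s, t, hs, ht, hst, e⟩ := h
  have h1 := congrArg Complex.im e
  simp only [nodeCoords, List.mem_cons, List.not_mem_nil, or_false] at hp
  rcases hp with rfl | rfl | rfl | rfl <;> simp [coord] at h1 ⊢

theorem hyp_side {p : ℤ × ℤ} (hp : p ∈ nodeCoords) (h : coord p ∈ segment ℝ I 2) :
    p = (0, 1) ∨ p = (2, 0) := by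
  obtain ⟨s, t, hs, ht, hst, e⟩ := h
  have h1 := congrArg Complex.re e
  have h2 := congrArg Complex.im e
  simp only [nodeCoords, List.mem_cons, List.not_mem_nil, or_false] at hp
  rcases hp with rfl | rfl | rfl | rfl <;> simp [coord] at h1 h2 ⊢ <;> linarith

theorem IsPinwheelTiling.exists_node_of_mem_segment {𝒯 : Set Triangle}
    (h𝒯 : IsPinwheelTiling 𝒯) {M : Motion} (hM : M.tri ∈ 𝒯) {a b : ℂ} (ha : a ∈ prototile)
    (hb : b ∈ prototile) {z : ℂ} (hz : z ∈ segment ℝ (M.app a) (M.app b))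
    (hv : z ∈ vertices 𝒯) :
    ∃ p ∈ nodeCoords, coord p ∈ segment ℝ a b ∧ z = M.app (coord p) := by
  obtain ⟨w, hw, rfl⟩ := Motion.exists_of_mem_segment hz
  obtain ⟨p, hp, rfl⟩ := h𝒯.exists_node hM (convex_prototile.segment_subset ha hb hw) hv
  exact ⟨p, hp, hw, rfl⟩

theorem zero_mem_prototile : (0 : ℂ) ∈ prototile := by simp [prototile]

theorem I_mem_prototile : I ∈ prototile := by simp [prototile]

theorem two_mem_prototile : (2 : ℂ) ∈ prototile := by simp [prototile]

/-- The edges of the graph of a pinwheel tiling on a side of a tile. -/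
theorem IsPinwheelTiling.exists_edgeKind {𝒯 : Set Triangle} (h𝒯 : IsPinwheelTiling 𝒯) {M : Motion}
    (hM : M.tri ∈ 𝒯) {x y : vertices 𝒯} (hxy : (tilingGraph 𝒯).Adj x y) {s : Set ℂ}
    (hs : s ∈ M.tri.sides) (hx : (x : ℂ) ∈ s) (hy : (y : ℂ) ∈ s) :
    ∃ k : EdgeKind, k.Valid M (vertices 𝒯) ∧
      SameEnds (x : ℂ) y (M.app (coord k.fst)) (M.app (coord k.snd)) := by
  have hne : (x : ℂ) ≠ y := fun h => hxy.1 (Subtype.ext h)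
  have hno := hxy.2.2
  have hxv := x.2
  have hyv := y.2
  generalize (x : ℂ) = x at *
  generalize (y : ℂ) = y at *
  have hmid := M.mid_mem_openSegment
  rcases hs with rfl | rfl | rfl
  · obtain ⟨p, hp, hps, rfl⟩ :=
      h𝒯.exists_node_of_mem_segment hM zero_mem_prototile I_mem_prototile hx hxv
    obtain ⟨q, hq, hqs, rfl⟩ :=
      h𝒯.exists_node_of_mem_segment hM zero_mem_prototile I_mem_prototile hy hyv
    refine ⟨.short, by simp [EdgeKind.Valid], ?_⟩
    rcases short_side hp hps with rfl | rfl <;> rcases short_side hq hqs with rfl | rfl <;>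
      first | exact absurd rfl hne | simp [SameEnds, EdgeKind.fst, EdgeKind.snd]
  · obtain ⟨p, hp, hps, rfl⟩ :=
      h𝒯.exists_node_of_mem_segment hM zero_mem_prototile two_mem_prototile hx hxv
    obtain ⟨q, hq, hqs, rfl⟩ :=
      h𝒯.exists_node_of_mem_segment hM zero_mem_prototile two_mem_prototile hy hyv
    rcases long_side hp hps with rfl | rfl | rfl <;>
      rcases long_side hq hqs with rfl | rfl | rfl
    · exact absurd rfl hne
    · exact ⟨.near, by simp [EdgeKind.Valid, hyv], by simp [SameEnds, EdgeKind.fst, EdgeKind.snd]⟩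
    · exact ⟨.long, by simpa [EdgeKind.Valid] using fun h => hno _ h hmid,
        by simp [SameEnds, EdgeKind.fst, EdgeKind.snd]⟩
    · exact ⟨.near, by simp [EdgeKind.Valid, hxv], by simp [SameEnds, EdgeKind.fst, EdgeKind.snd]⟩
    · exact absurd rfl hne
    · exact ⟨.far, by simp [EdgeKind.Valid, hxv], by simp [SameEnds, EdgeKind.fst, EdgeKind.snd]⟩
    · rw [openSegment_symm] at hmid
      exact ⟨.long, by simpa [EdgeKind.Valid] using fun h => hno _ h hmid,
        by simp [SameEnds, EdgeKind.fst, EdgeKind.snd]⟩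
    · exact ⟨.far, by simp [EdgeKind.Valid, hyv], by simp [SameEnds, EdgeKind.fst, EdgeKind.snd]⟩
    · exact absurd rfl hne
  · obtain ⟨p, hp, hps, rfl⟩ :=
      h𝒯.exists_node_of_mem_segment hM I_mem_prototile two_mem_prototile hx hxv
    obtain ⟨q, hq, hqs, rfl⟩ :=
      h𝒯.exists_node_of_mem_segment hM I_mem_prototile two_mem_prototile hy hyv
    refine ⟨.hyp, by simp [EdgeKind.Valid], ?_⟩
    rcases hyp_side hp hps with rfl | rfl <;> rcases hyp_side hq hqs with rfl | rfl <;>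
      first | exact absurd rfl hne | simp [SameEnds, EdgeKind.fst, EdgeKind.snd]

theorem SameEnds.meet {α : Type*} {x y X Y x' y' X' Y' : α} (h : SameEnds x y X Y)
    (h' : SameEnds x' y' X' Y') (hm : Meet x y x' y') : Meet X Y X' Y' := by
  rcases h with ⟨rfl, rfl⟩ | ⟨rfl, rfl⟩ <;> rcases h' with ⟨rfl, rfl⟩ | ⟨rfl, rfl⟩ <;>
    simp only [Meet] at hm ⊢ <;> tauto

theorem SameEnds.trans' {α : Type*} {x y X Y x' y' X' Y' : α} (h : SameEnds x y X Y)
    (h' : SameEnds x' y' X' Y') (hm : SameEnds X Y X' Y') : SameEnds x y x' y' := by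
  rcases h with ⟨rfl, rfl⟩ | ⟨rfl, rfl⟩ <;> rcases h' with ⟨rfl, rfl⟩ | ⟨rfl, rfl⟩ <;>
    simp only [SameEnds] at hm ⊢ <;> tauto

/-! ### Upper bound -/

/-- The triangle at position `m` relative to a triangle. -/
noncomputable def Triangle.relative (T : Triangle) (m : Motion) : Triangle :=
  ⟨T.point (m.app 0), T.point (m.app I), T.point (m.app 2)⟩

theorem Motion.relative_tri (M m : Motion) : M.tri.relative m = (M * m).tri := by
  simp only [Triangle.relative, point_tri, ← mul_app]
  rfl

/-- A supertile vertex on a tile is a corner of one of its neighbours in the supertile; it suffices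
that these neighbours belong to the tiling. -/
theorem tri_mem_vertices {S : Motion} (hS : S.u ≠ 0) {𝒯 : Set Triangle} {l : List (Fin 5)} {n : ℕ}
    (hl : l.length = n)
    (h : ∀ r ∈ neighbours, (descend S l).tri.relative (r.toMotion 25) ∈ supertile S n →
      (descend S l).tri.relative (r.toMotion 25) ∈ 𝒯) {w : ℂ} (hw : w ∈ prototile)
    (hv : (descend S l).app w ∈ vertices (supertile S n)) : (descend S l).app w ∈ vertices 𝒯 := by
  obtain ⟨l', hl', q, hq, e⟩ := vertices_supertile.1 hv
  obtain ⟨r, hr, hrel⟩ := exists_neighbour hS (hl.trans hl'.symm) hw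
    (coord_mem_prototile (cornerCoords_subset hq)) e
  have ht := h r hr
  rw [Motion.relative_tri, ← hrel] at ht
  exact ⟨_, ht ⟨l', hl', rfl⟩, Motion.mem_corners_iff.2 ⟨q, hq, e⟩⟩

/-- Each edge takes its colour from one chosen tile. The tile on the other side might give another
colour, which is harmless since properness holds for every choice. -/
theorem IsPinwheelTiling.exists_colouring {𝒯 : Set Triangle} (h𝒯 : IsPinwheelTiling 𝒯)
    {E : Set (tilingGraph 𝒯).edgeSet} (hE : E.Finite) :
    ∃ c : E → ZMod 8, ∀ e e' : E, (tilingGraph 𝒯).lineGraph.Adj e e' → c e ≠ c e' := by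
  classical
  have hdata : ∀ e : (tilingGraph 𝒯).edgeSet, ∃ x y : vertices 𝒯, e.1 = s(x, y) ∧
      (tilingGraph 𝒯).Adj x y := by
    rintro ⟨⟨x, y⟩, h⟩
    exact ⟨x, y, rfl, h⟩
  choose x y hxy hadj using hdata
  choose T hT s hs hxs hys using fun e => (hadj e).2.1
  -- A tile having the midpoint of the long leg as a corner, if there is one: including it makes the
  -- midpoint a vertex of the supertile too.
  let g : (tilingGraph 𝒯).edgeSet → Triangle := fun e =>
    if h : (T e).point (coord (1, 0)) ∈ vertices 𝒯 then h.choose else T e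
  have hg : ∀ e, g e ∈ 𝒯 := by
    intro e
    simp only [g]
    split_ifs with h
    exacts [h.choose_spec.1, hT e]
  obtain ⟨S, n, hS, hF, hY⟩ := h𝒯.exists_supertile (F := T '' E ∪ g '' E)
    -- Conversely, all supertile neighbours of the chosen tiles are forced into the tiling, so that
    -- the supertile divides no long leg that the tiling leaves undivided.
    (Y := ⋃ e ∈ E, (fun r => (T e).relative (r.toMotion 25)) '' {r | r ∈ neighbours})
    ((hE.image T).union (hE.image g))
    (by rintro _ (⟨e, -, rfl⟩ | ⟨e, -, rfl⟩); exacts [hT e, hg e])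
    (hE.biUnion fun e _ => (List.finite_toSet neighbours).image _)
  have hkind : ∀ e : E, ∃ (i : Fin 5) (l : List (Fin 5)) (k : EdgeKind), l.length = n + 1 ∧
      k.Valid (descend S (i :: l)) (vertices (supertile S (l.length + 1))) ∧
      SameEnds (x e : ℂ) (y e) ((descend S (i :: l)).app (coord k.fst))
        ((descend S (i :: l)).app (coord k.snd)) := by
    intro e
    obtain ⟨_ | ⟨i, l⟩, hl, hTl⟩ := hF (Or.inl ⟨e, e.2, rfl⟩)
    · simp at hl
    have hl' : l.length = n + 1 := by simpa using hl
    have hsM := hs e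
    have hM := hT e
    rw [hTl] at hsM hM
    obtain ⟨k, hk, hends⟩ := h𝒯.exists_edgeKind hM (hadj e) hsM (hxs e) (hys e)
    refine ⟨i, l, k, hl', ⟨fun h => ?_, fun h hv => ?_⟩, hends⟩
    · have hv := hk.1 h
      have hv' : (T e).point (coord (1, 0)) ∈ vertices 𝒯 := by rwa [hTl, Motion.point_tri]
      have hge : g e = hv'.choose := dif_pos hv'
      have hmem := hF (Or.inr ⟨e, e.2, rfl⟩)
      rw [hge] at hmem
      rw [hl', ← Motion.point_tri, ← hTl]
      exact ⟨_, hmem, hv'.choose_spec.2⟩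
    · rw [hl'] at hv
      refine hk.2 h (tri_mem_vertices hS hl (fun r hr hP => hY ⟨?_, hP⟩)
        (coord_mem_prototile (by decide)) hv)
      rw [← hTl]
      exact Set.mem_biUnion e.2 ⟨r, hr, rfl⟩
  choose i l k hl hk hends using hkind
  refine ⟨fun e => (k e).colour (descend S (i e :: l e)).flip (descend S (i e :: l e)).label,
    fun e e' h => ?_⟩
  obtain ⟨hne, v, hv, hv'⟩ := SimpleGraph.lineGraph_adj_iff_exists.1 h
  refine colour_ne_of_meet hS ((hl e).trans (hl e').symm) (hk e)
    (by have := hk e'; rwa [hl e', ← hl e] at this) ?_ ?_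
  · refine (hends e).meet (hends e') ?_
    rw [hxy, Sym2.mem_iff] at hv hv'
    rcases hv with rfl | rfl <;> rcases hv' with h | h <;> simp [Meet, h]
  · intro hsame
    have := (hends e).trans' (hends e') hsame
    refine hne (Subtype.ext ?_)
    rw [hxy, hxy, Sym2.eq_iff]
    rcases this with ⟨h1, h2⟩ | ⟨h1, h2⟩
    · exact Or.inl ⟨Subtype.ext h1, Subtype.ext h2⟩
    · exact Or.inr ⟨Subtype.ext h1, Subtype.ext h2⟩

/-- The de Bruijn–Erdős compactness argument, applied to the line graph with the complete graph on
`ZMod 8` as target. -/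
theorem IsPinwheelTiling.colorable {𝒯 : Set Triangle} (h𝒯 : IsPinwheelTiling 𝒯) :
    (tilingGraph 𝒯).lineGraph.Colorable 8 := by
  obtain ⟨f⟩ := SimpleGraph.nonempty_hom_of_forall_finite_subgraph_hom
    (G := (tilingGraph 𝒯).lineGraph) (F := (⊤ : SimpleGraph (ZMod 8))) fun G' hG' =>
      Classical.choice (by
        obtain ⟨c, hc⟩ := h𝒯.exists_colouring hG'
        exact ⟨⟨c, fun {e e'} h => hc e e' (G'.adj_sub h)⟩⟩)
  have := SimpleGraph.Coloring.colorable (α := ZMod 8) f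
  rwa [ZMod.card] at this

/-! ### Lower bound -/

theorem conjIf_conjIf (f : Bool) (z : ℂ) : conjIf f (conjIf f z) = z := by
  cases f <;> simp [conjIf, sgn]

theorem Motion.app_surjective {M : Motion} (hM : M.u ≠ 0) : Function.Surjective M.app := by
  intro z
  refine ⟨conjIf M.flip ((z - M.c) / M.u), ?_⟩
  rw [app, conjIf_conjIf, mul_div_cancel₀ _ hM]
  ring

theorem Motion.tri_mul_eq {A B m m' : Motion} (hm : m.u ≠ 0) (h : (A * m).tri = (B * m).tri) :
    (A * m').tri = (B * m').tri := by
  have happ : ∀ z, A.app z = B.app z := by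
    intro z
    obtain ⟨z, rfl⟩ := app_surjective hm z
    rw [← mul_app, ← mul_app, app_eq_of_tri_eq h]
  simp only [tri, mul_app, happ]

/-- A pinwheel tiling contains a supertile of level two. -/
theorem IsPinwheelTiling.exists_supertile_two {𝒯 : Set Triangle} (h𝒯 : IsPinwheelTiling 𝒯) :
    ∃ X : Motion, X.u ≠ 0 ∧
      ∀ a b, (X * ((kid a).toMotion 5 * (kid b).toMotion 5)).tri ∈ 𝒯 := by
  obtain ⟨T, hT⟩ := h𝒯.infinite.nonempty
  have hku : ∀ i, ((kid i).toMotion 5).u ≠ 0 := fun i =>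
    toMotion_u_ne_zero (by norm_num) (kid_nrm_ne_zero i)
  -- If `T` has the position `t.1` in a level-two supertile, its companion at position `t.2` is
  -- determined, so only finitely many candidates arise.
  let Y : (Fin 5 × Fin 5) × Fin 5 × Fin 5 → Set Triangle := fun t =>
    {T' | ∃ X : Motion, T = (X * ((kid t.1.1).toMotion 5 * (kid t.1.2).toMotion 5)).tri ∧
      T' = (X * ((kid t.2.1).toMotion 5 * (kid t.2.2).toMotion 5)).tri}
  have hYfin : ∀ t, (Y t).Finite := by
    intro t
    refine Set.Subsingleton.finite ?_
    rintro _ ⟨A, hA, rfl⟩ _ ⟨B, hB, rfl⟩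
    exact Motion.tri_mul_eq (Motion.mul_u_ne_zero (hku _) (hku _)) (hA.symm.trans hB)
  obtain ⟨S, n, hS, hF, hY⟩ := h𝒯.exists_supertile (F := {T}) (Y := ⋃ t, Y t)
    (Set.finite_singleton T) (by simpa using hT) (Set.finite_iUnion hYfin)
  obtain ⟨l, hl, hTl⟩ := hF rfl
  -- Level `n + 2` gives the word at least two letters; dropping the last two dissections yields the
  -- level-two supertile around `T`.
  match l, hl, hTl with
  | i :: j :: l, hl, hTl =>
    simp only [List.length_cons, Nat.add_right_cancel_iff] at hl
    refine ⟨descend S l, descend_u_ne_zero hS l, fun a b => hY ⟨?_, b :: a :: l, by simp [hl], ?_⟩⟩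
    · refine Set.mem_iUnion.2 ⟨((j, i), a, b), descend S l, ?_, rfl⟩
      rw [hTl, descend, descend, Motion.mul_assoc']
    · rw [descend, descend, Motion.mul_assoc']

theorem Motion.segment_mem_sides (M : Motion) {p q : ℤ × ℤ} (hp : p ∈ cornerCoords)
    (hq : q ∈ cornerCoords) (hpq : p ≠ q) :
    segment ℝ (M.app (coord p)) (M.app (coord q)) ∈ M.tri.sides := by
  have h0 : coord (0, 0) = 0 := by simp [coord, Complex.ext_iff]
  have h1 : coord (0, 1) = I := by simp [coord, Complex.ext_iff]
  have h2 : coord (2, 0) = 2 := by simp [coord, Complex.ext_iff]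
  simp only [cornerCoords, List.mem_cons, List.not_mem_nil, or_false] at hp hq
  rcases hp with rfl | rfl | rfl <;> rcases hq with rfl | rfl | rfl <;>
    first
    | exact absurd rfl hpq
    | (simp only [Triangle.sides, tri, h0, h1, h2]; simp; done)
    | (rw [segment_symm]; simp only [Triangle.sides, tri, h0, h1, h2]; simp)

theorem Motion.exists_of_mem_openSegment {M : Motion} {a b z : ℂ}
    (hz : z ∈ openSegment ℝ (M.app a) (M.app b)) : ∃ w ∈ openSegment ℝ a b, z = M.app w := by
  obtain ⟨s, t, hs, ht, hst, rfl⟩ := hz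
  exact ⟨_, ⟨s, t, hs, ht, hst, rfl⟩, (M.app_combo a b hst).symm⟩

theorem node_eq_midpoint {p q o : ℤ × ℤ} (hp : p ∈ cornerCoords) (hq : q ∈ cornerCoords)
    (ho : o ∈ nodeCoords) (hpq : p ≠ q) (h : coord o ∈ openSegment ℝ (coord p) (coord q)) :
    coord o = (1 / 2 : ℝ) • coord p + (1 / 2 : ℝ) • coord q := by
  obtain ⟨s, t, hs, ht, hst, e⟩ := h
  have h1 := congrArg Complex.re e
  have h2 := congrArg Complex.im e
  simp only [cornerCoords, nodeCoords, List.mem_cons, List.not_mem_nil, or_false] at hp hq ho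
  rcases hp with rfl | rfl | rfl <;> rcases hq with rfl | rfl | rfl <;>
    rcases ho with rfl | rfl | rfl | rfl <;>
    first
    | exact absurd rfl hpq
    | (exfalso; simp [coord] at h1 h2 <;> linarith)
    | (apply Complex.ext <;> simp [coord])

theorem openSegment_subset_of_mem {x y z : ℂ} (hz : z ∈ openSegment ℝ x y) :
    openSegment ℝ x z ⊆ openSegment ℝ x y := by
  rintro _ ⟨a, b, ha, hb, hab, rfl⟩
  obtain ⟨s, t, hs, ht, hst, rfl⟩ := hz
  exact ⟨a + b * s, b * t, by positivity, by positivity, by linear_combination hab + b * hst,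
    by module⟩

/-- Each side of a tile starting at a vertex begins with an edge at that vertex, which leads to the
other end of the side or to its midpoint. -/
theorem IsPinwheelTiling.exists_adj {𝒯 : Set Triangle} (h𝒯 : IsPinwheelTiling 𝒯) {M : Motion}
    (hM : M.tri ∈ 𝒯) (hu : M.u ≠ 0) {p q : ℤ × ℤ} (hp : p ∈ cornerCoords) (hq : q ∈ cornerCoords)
    (hpq : p ≠ q) {v : vertices 𝒯} (hv : (v : ℂ) = M.app (coord p)) :
    ∃ (x : vertices 𝒯) (s : ℤ), (s = 1 ∨ s = 2) ∧ (tilingGraph 𝒯).Adj v x ∧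
      (x : ℂ) = (1 - s / 2 : ℝ) • M.app (coord p) + (s / 2 : ℝ) • M.app (coord q) := by
  have hside := M.segment_mem_sides hp hq hpq
  have hmem : ∀ {p}, p ∈ cornerCoords → coord p ∈ prototile := fun h =>
    coord_mem_prototile (cornerCoords_subset h)
  have hmid : ∀ z ∈ vertices 𝒯, z ∈ openSegment ℝ (M.app (coord p)) (M.app (coord q)) →
      z = (1 / 2 : ℝ) • M.app (coord p) + (1 / 2 : ℝ) • M.app (coord q) := by
    intro z hz hzs
    obtain ⟨w, hw, rfl⟩ := Motion.exists_of_mem_openSegment hzs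
    obtain ⟨o, ho, rfl⟩ := h𝒯.exists_node hM
      (convex_prototile.openSegment_subset (hmem hp) (hmem hq) hw) hz
    rw [node_eq_midpoint hp hq ho hpq hw, M.app_combo _ _ (by norm_num)]
  have hne : M.app (coord p) ≠ M.app (coord q) := by
    intro h
    have h := M.app_injective hu h
    exact hpq (coord_div_injective (n := 1) (by norm_num) (by rw [h]))
  by_cases hz : ∃ z ∈ vertices 𝒯, z ∈ openSegment ℝ (M.app (coord p)) (M.app (coord q))
  · obtain ⟨z, hz, hzs⟩ := hz
    have hzm := hmid z hz hzs
    refine ⟨⟨z, hz⟩, 1, Or.inl rfl, ⟨?_, ⟨_, hM, _, hside, ?_, ?_⟩, ?_⟩, ?_⟩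
    · intro h
      have h : M.app (coord p) = z := by rw [← hv, h]
      rw [← h] at hzs
      exact hne (left_mem_openSegment_iff.1 hzs)
    · rw [hv]; exact left_mem_segment ℝ _ _
    · exact openSegment_subset_segment ℝ _ _ hzs
    · intro z' hz' hzs'
      rw [hv] at hzs'
      have h' := hmid z' hz' (openSegment_subset_of_mem hzs hzs')
      rw [h', ← hzm] at hzs'
      have h'' : M.app (coord p) = z := right_mem_openSegment_iff.1 hzs'
      rw [← h''] at hzs
      exact hne (left_mem_openSegment_iff.1 hzs)
    · exact hzm.trans (by norm_num)
  · push Not at hz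
    refine ⟨⟨M.app (coord q), _, hM, Motion.mem_corners_iff.2 ⟨q, hq, rfl⟩⟩, 2, Or.inr rfl,
      ⟨?_, ⟨_, hM, _, hside, ?_, ?_⟩, ?_⟩, ?_⟩
    · intro h
      exact hne (by rw [← hv, h])
    · rw [hv]; exact left_mem_segment ℝ _ _
    · exact right_mem_segment ℝ _ _
    · rw [hv]; exact hz
    · norm_num

/-- The tile in the twice dissected prototile with indices `a` and `b`, at scale `25`. -/
def grandKid (a b : Fin 5) : Placement := comp 5 (kid a) (kid b)

/-- Eight sides of tiles in the twice dissected prototile that issue from a common vertex: the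
indices of the tile, and the ends of the side. -/
def star : Fin 8 → (Fin 5 × Fin 5) × (ℤ × ℤ) × ℤ × ℤ
  | 0 => ((0, 1), (2, 0), (0, 1))
  | 1 => ((0, 1), (2, 0), (0, 0))
  | 2 => ((0, 2), (2, 0), (0, 1))
  | 3 => ((0, 3), (0, 1), (0, 0))
  | 4 => ((0, 4), (0, 1), (2, 0))
  | 5 => ((1, 0), (2, 0), (0, 0))
  | 6 => ((2, 0), (2, 0), (0, 0))
  | 7 => ((1, 1), (0, 1), (2, 0))

/-- The common vertex of the star, at scale `25`. -/
def hub : ℤ × ℤ := (grandKid 0 1).pt (2, 0)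

theorem star_fst (i : Fin 8) :
    (grandKid (star i).1.1 (star i).1.2).pt (star i).2.1 = hub := by
  revert i; decide

theorem star_corner (i : Fin 8) : (star i).2.1 ∈ cornerCoords ∧ (star i).2.2 ∈ cornerCoords ∧
    (star i).2.1 ≠ (star i).2.2 := by
  revert i; decide

/-- The midpoint (`s = 1`) or the end (`s = 2`) of a side in the star, at scale `50`. -/
def ray (i : Fin 8) (s : ℤ) : ℤ × ℤ :=
  let y := (grandKid (star i).1.1 (star i).1.2).pt (star i).2.2
  ((2 - s) * hub.1 + s * y.1, (2 - s) * hub.2 + s * y.2)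

theorem ray_injective : ∀ i j : Fin 8, i ≠ j → ∀ s ∈ [(1 : ℤ), 2], ∀ s' ∈ [(1 : ℤ), 2],
    ray i s ≠ ray j s' := by
  decide +kernel

/-- The hub is the point `G` of the first dissection. Five rays come from child 0, on whose long leg
`G` is the midpoint. The others are the altitudes of children 1 and 2 from their right angle, and
their common leg `GF`. The eight edges form a clique in the line graph. -/
theorem IsPinwheelTiling.eight_le {𝒯 : Set Triangle} (h𝒯 : IsPinwheelTiling 𝒯) :
    8 ≤ (tilingGraph 𝒯).lineGraph.chromaticNumber := by
  obtain ⟨X, hX, hkids⟩ := h𝒯.exists_supertile_two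
  have happ : ∀ a b q, (X * ((kid a).toMotion 5 * (kid b).toMotion 5)).app (coord q) =
      X.app (coord ((grandKid a b).pt q) / (25 : ℤ)) := by
    intro a b q
    rw [← toMotion_comp (by norm_num) (by norm_num), Motion.mul_app, app_coord]
    rfl
  have hu : ∀ a b, (X * ((kid a).toMotion 5 * (kid b).toMotion 5)).u ≠ 0 := fun a b =>
    Motion.mul_u_ne_zero hX (Motion.mul_u_ne_zero
      (toMotion_u_ne_zero (by norm_num) (kid_nrm_ne_zero a))
      (toMotion_u_ne_zero (by norm_num) (kid_nrm_ne_zero b)))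
  let v : vertices 𝒯 := ⟨X.app (coord hub / (25 : ℤ)), _, hkids 0 1,
    Motion.mem_corners_iff.2 ⟨(2, 0), by decide, (happ _ _ _).symm⟩⟩
  have hadj : ∀ i : Fin 8, ∃ (x : vertices 𝒯) (s : ℤ), (s = 1 ∨ s = 2) ∧
      (tilingGraph 𝒯).Adj v x ∧ (x : ℂ) = X.app (coord (ray i s) / (50 : ℤ)) := by
    intro i
    obtain ⟨hp, hq, hpq⟩ := star_corner i
    obtain ⟨x, s, hs, hx, e⟩ := h𝒯.exists_adj (hkids (star i).1.1 (star i).1.2) (hu _ _) hp hq hpq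
      (v := v) (by rw [happ, star_fst])
    refine ⟨x, s, hs, hx, ?_⟩
    rw [e, happ, happ, star_fst, ← Motion.app_combo _ _ _ (by ring)]
    congr 1
    apply Complex.ext <;> simp [coord, ray] <;> ring
  choose x s hs hx e using hadj
  -- It is unknown which sides are divided, so the points are separated for every combination of
  -- midpoints and ends.
  have hinj : ∀ i j, i ≠ j → x i ≠ x j := by
    intro i j hij h
    have h' : (x i : ℂ) = x j := by rw [h]
    rw [e, e] at h'
    exact ray_injective i j hij (s i) (by simpa using hs i) (s j) (by simpa using hs j)
      (coord_div_injective (by norm_num) (Motion.app_injective hX h'))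
  let f : (⊤ : SimpleGraph (Fin 8)) →g (tilingGraph 𝒯).lineGraph :=
    { toFun := fun i => ⟨s(v, x i), hx i⟩
      map_rel' := by
        intro i j hij
        refine SimpleGraph.lineGraph_adj_iff_exists.2 ⟨fun h => hinj i j hij ?_, v, by simp, by simp⟩
        exact Sym2.congr_right.1 (congrArg Subtype.val h) }
  have := SimpleGraph.chromaticNumber_mono_of_hom f
  rw [SimpleGraph.chromaticNumber_top] at this
  exact_mod_cast this

end Pinwheel

theorem theorem6p7 (𝒯 : Set Pinwheel.Triangle) (h𝒯 : Pinwheel.IsPinwheelTiling 𝒯) :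
    (Pinwheel.tilingGraph 𝒯).chromaticIndex = 8 :=
  le_antisymm h𝒯.colorable.chromaticNumber_le h𝒯.eight_le
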